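/- Let $d\ge 1$, let $\sigma,\bar\alpha$ be real $d\times d$ matrices, and let $(\lambda^{i,j})_{0\le i,j\le d}$ be real numbers with $\lambda^{i,i}=0$ and $\lambda^{i,j}>0$ for $i\ne j$. For $\rho=(\rho_1,\dots,\rho_d)\in\mathbb R^d$ put $\rho_0:=0$, and let $$ C:=\{\rho\in\mathbb R^d:\ -\lambda^{j,i}\le \rho_i-\rho_j\le\lambda^{i,j}\ \text{ for all } 0\le i,j\le d\},\qquad \delta_C(\rho):=\sup_{u\in C}u\cdot\rho . $$ The first corrector equation with eigenvalue $a\in\mathbb R$ is the equation, for $w:\mathbb R^d\to\mathbb R$, $$ \max_{0\le i\ne j\le d}\max\Big\{-\frac{|\sigma\rho|^2}{2}-\frac12\operatorname{Tr}\big[\bar\alpha\bar\alpha^{T}D^2w(\rho)\big]+a\ ;\ -\lambda^{i,j}+\frac{\partial w}{\partial\rho_i}(\rho)-\frac{\partial w}{\partial\rho_j}(\rho)\Big\}=0,\qquad \rho\in\mathbb R^d, $$ with the convention $\partial w/\partial\rho_0:=0$. Write $F_a(\rho,p,X)$ for its left-hand side with $Dw(\rho)$, $D^2w(\rho)$ replaced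 by $p\in\mathbb R^d$ and a symmetric matrix $X$. A viscosity subsolution (resp. supersolution) is an upper (resp. lower) semicontinuous function $w:\mathbb R^d\to\mathbb R$ such that $F_a(\rho,p,X)\le 0$ (resp. $\ge 0$) for every $\rho\in\mathbb R^d$ and every $(p,X)$ in the second-order superjet $J^{2,+}w(\rho)$ (resp. subjet $J^{2,-}w(\rho)$), i.e. every $p\in\mathbb R^d$ and symmetric $X$ with $w(y)\le w(\rho)+p\cdot(y-\rho)+\frac12X(y-\rho)\cdot(y-\rho)+o(|y-\rho|^2)$ (resp. $\ge$) as $y\to\rho$. Let $w_1$ be a viscosity subsolution of the first corrector equation with eigenvalue $a_1$, and let $w_2$ be a viscosity supersolution of it with eigenvalue $a_2$. Assume that $$ \limsup_{|\rho|\to\infty}\frac{w_1(\rho)}{\delta_C(\rho)}\ \le\ 1\ \le\ \liminf_{|\rho|\to\infty}\frac{w_2(\rho)}{\delta_C(\rho)} . $$ Then $a_1\le a_2$. -/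

import Mathlib

open Filter Topology

noncomputable section

namespace Corrector

/-- The vector `(0, p₁, …, p_d)`: the components of `p ∈ ℝ^d` numbered `0, …, d`, with the
convention `p₀ = 0`. -/
def extend {d : ℕ} (p : EuclideanSpace ℝ (Fin d)) : Fin (d + 1) → ℝ :=
  Fin.cons 0 (fun i => p i)

/-- The polyhedral gradient-constraint set
`C = {ρ : -λ^{j,i} ≤ ρ_i - ρ_j ≤ λ^{i,j}, 0 ≤ i, j ≤ d}`, with `ρ₀ = 0`. -/
def constraintSet {d : ℕ} (lam : Fin (d + 1) → Fin (d + 1) → ℝ) :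
    Set (EuclideanSpace ℝ (Fin d)) :=
  {p | ∀ i j, -lam j i ≤ extend p i - extend p j ∧ extend p i - extend p j ≤ lam i j}

/-- The support function `δ_S(ρ) = sup_{u ∈ S} u · ρ`. -/
def supportFunction {d : ℕ} (S : Set (EuclideanSpace ℝ (Fin d)))
    (x : EuclideanSpace ℝ (Fin d)) : ℝ :=
  ⨆ u : S, inner ℝ (u : EuclideanSpace ℝ (Fin d)) x

/-- The second-order superjet `J^{2,+} w(x)`: the pairs `(p, X)`, `X` symmetric, with
`w(y) ≤ w(x) + p · (y - x) + ½ X(y - x) · (y - x) + o(|y - x|²)` as `y → x`. -/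
def superjet {d : ℕ} (w : EuclideanSpace ℝ (Fin d) → ℝ) (x : EuclideanSpace ℝ (Fin d)) :
    Set (EuclideanSpace ℝ (Fin d) × Matrix (Fin d) (Fin d) ℝ) :=
  {q | q.2.IsSymm ∧ ∀ ε : ℝ, 0 < ε → ∀ᶠ y in 𝓝 x,
    w y ≤ w x + inner ℝ q.1 (y - x)
      + 1 / 2 * inner ℝ (Matrix.toEuclideanLin q.2 (y - x)) (y - x) + ε * ‖y - x‖ ^ 2}

/-- The second-order subjet `J^{2,-} w(x)`: the pairs `(p, X)`, `X` symmetric, with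
`w(y) ≥ w(x) + p · (y - x) + ½ X(y - x) · (y - x) + o(|y - x|²)` as `y → x`. -/
def subjet {d : ℕ} (w : EuclideanSpace ℝ (Fin d) → ℝ) (x : EuclideanSpace ℝ (Fin d)) :
    Set (EuclideanSpace ℝ (Fin d) × Matrix (Fin d) (Fin d) ℝ) :=
  {q | q.2.IsSymm ∧ ∀ ε : ℝ, 0 < ε → ∀ᶠ y in 𝓝 x,
    w x + inner ℝ q.1 (y - x)
      + 1 / 2 * inner ℝ (Matrix.toEuclideanLin q.2 (y - x)) (y - x) - ε * ‖y - x‖ ^ 2 ≤ w y}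

/-- The operator of the first corrector equation with eigenvalue `a`, at the point `x`, gradient
`p` and Hessian `X`: the maximum of `-|σ x|²/2 - ½ Tr(α αᵀ X) + a` and of the numbers
`-λ^{i,j} + p_i - p_j`, `0 ≤ i ≠ j ≤ d`, where `p₀ = 0`. (The diagonal terms `i = j` are
identically zero and constrain nothing; they are no part of the maximum.) -/
def correctorOp {d : ℕ} (sig alp : Matrix (Fin d) (Fin d) ℝ)
    (lam : Fin (d + 1) → Fin (d + 1) → ℝ) (a : ℝ)
    (x p : EuclideanSpace ℝ (Fin d)) (X : Matrix (Fin d) (Fin d) ℝ) : ℝ :=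
  (Finset.univ : Finset (Fin (d + 1))).offDiag.fold max
    (-(‖Matrix.toEuclideanLin sig x‖ ^ 2 / 2) - 1 / 2 * (alp * alp.transpose * X).trace + a)
    (fun ij => -lam ij.1 ij.2 + extend p ij.1 - extend p ij.2)

/-- Viscosity subsolution on `ℝ^d` of the first corrector equation with eigenvalue `a`. -/
def IsViscositySubsolution {d : ℕ} (sig alp : Matrix (Fin d) (Fin d) ℝ)
    (lam : Fin (d + 1) → Fin (d + 1) → ℝ) (a : ℝ) (w : EuclideanSpace ℝ (Fin d) → ℝ) : Prop :=
  UpperSemicontinuous w ∧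
    ∀ x, ∀ q ∈ superjet w x, correctorOp sig alp lam a x q.1 q.2 ≤ 0

/-- Viscosity supersolution on `ℝ^d` of the first corrector equation with eigenvalue `a`. -/
def IsViscositySupersolution {d : ℕ} (sig alp : Matrix (Fin d) (Fin d) ℝ)
    (lam : Fin (d + 1) → Fin (d + 1) → ℝ) (a : ℝ) (w : EuclideanSpace ℝ (Fin d) → ℝ) : Prop :=
  LowerSemicontinuous w ∧
    ∀ x, ∀ q ∈ subjet w x, 0 ≤ correctorOp sig alp lam a x q.1 q.2

end Corrector

end

/-! If `w₁` were smooth, the proof would be short. Maximise `(1 - ε) w₁ - w₂`, which tends to `-∞`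
by the growth assumptions. At a maximum point `(1 - ε) D w₁` satisfies all gradient constraints
strictly, because `λ^{i,j} > 0`, so the supersolution inequality for `w₂` must come from its
second-order branch. Combining it with the inequality for `w₁` and letting `ε → 0` gives `a₁ ≤ a₂`.

Smoothness is gained by mollifying `w₁` alone, without doubling variables. The gradient constraints
make `w₁` Lipschitz and bound its increments along `e_i - e_j` (`apply_add_smul_le`); both
properties survive convolution. The second-order inequality survives too
(`IsLinearSubsolution.mollify_le`), since it is linear with constant coefficients, but viscosity
inequalities cannot be integrated directly. They are first turned into a pointwise inequality `u ≤
P_t u + t f + o(t)`, where `P_t` is a random walk approximating the heat flow of the second-order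
operator (`le_walk`, `le_iterate_walk`). The walk is an average of translations, so it commutes with
convolution; expanding `P_t` on the smooth function and dividing by `t` gives the classical
inequality. Mollifying `|σρ|²/2` costs a factor `1 + ε` and a constant that vanishes with the
radius; the factor is absorbed by `1 - ε`. -/

noncomputable section

namespace Corrector

/-! ### Random walk approximation of the heat flow, and subsolutions along it -/

section Walk

variable {E : Type*} [NormedAddCommGroup E] [InnerProductSpace ℝ E]
variable {κ : Type*} [Fintype κ]

/-- The second-order operator `½ ∑ₖ B(αₖ, αₖ)` acting on bilinear forms. -/
def secondOrder (α : κ → E) (B : E →L[ℝ] E →L[ℝ] ℝ) : ℝ :=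
  1 / 2 * ∑ k, B (α k) (α k)

/-- `g` has the second-order expansion given by `G` and `H` at every point, with cubic error, and
`H` is Lipschitz; both with constant `K`. -/
structure JetBound (K : ℝ) (g : E → ℝ) (G : E → E →L[ℝ] ℝ) (H : E → E →L[ℝ] E →L[ℝ] ℝ) :
    Prop where
  symm : ∀ x v w, H x v w = H x w v
  taylor : ∀ x h, |g (x + h) - g x - G x h - 1 / 2 * H x h h| ≤ K * ‖h‖ ^ 3
  lip : ∀ x y, ‖H x - H y‖ ≤ K * ‖x - y‖

/-- One step of the symmetric random walk with increments `± s √|κ| αₖ`. -/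
def walk (α : κ → E) (s : ℝ) {V : Type*} [NormedAddCommGroup V] [NormedSpace ℝ V]
    (g : E → V) (x : E) : V :=
  (1 / (2 * (Fintype.card κ : ℝ))) • ∑ k, (g (x + (s * √(Fintype.card κ)) • α k)
    + g (x - (s * √(Fintype.card κ)) • α k))

/-- Viscosity subsolution of the linear equation `-½ ∑ₖ D²u(αₖ, αₖ) = f`. -/
def IsLinearSubsolution (α : κ → E) (f u : E → ℝ) : Prop :=
  ∀ (x : E) (p : E →L[ℝ] ℝ) (B : E →L[ℝ] E →L[ℝ] ℝ), (∀ v w, B v w = B w v) →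
    (∀ ε : ℝ, 0 < ε → ∀ᶠ y in 𝓝 x,
      u y ≤ u x + p (y - x) + 1 / 2 * B (y - x) (y - x) + ε * ‖y - x‖ ^ 2) →
    0 ≤ f x + secondOrder α B

theorem secondOrder_add (α : κ → E) (B B' : E →L[ℝ] E →L[ℝ] ℝ) :
    secondOrder α (B + B') = secondOrder α B + secondOrder α B' := by
  simp [secondOrder, Finset.sum_add_distrib, mul_add]

theorem secondOrder_smul (α : κ → E) (c : ℝ) (B : E →L[ℝ] E →L[ℝ] ℝ) :
    secondOrder α (c • B) = c * secondOrder α B := by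
  simp [secondOrder, ← Finset.mul_sum]; ring

theorem secondOrder_sub (α : κ → E) (B B' : E →L[ℝ] E →L[ℝ] ℝ) :
    secondOrder α (B - B') = secondOrder α B - secondOrder α B' := by
  simp [secondOrder, Finset.sum_sub_distrib, mul_sub]

theorem abs_secondOrder_le (α : κ → E) (B : E →L[ℝ] E →L[ℝ] ℝ) :
    |secondOrder α B| ≤ (1 / 2 * ∑ k, ‖α k‖ ^ 2) * ‖B‖ := by
  rw [secondOrder, abs_mul, abs_of_pos (by norm_num : (0 : ℝ) < 1 / 2), mul_assoc,
    Finset.sum_mul]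
  gcongr
  refine (Finset.abs_sum_le_sum_abs _ _).trans (Finset.sum_le_sum fun k _ => ?_)
  have := B.le_opNorm₂ (α k) (α k)
  rw [Real.norm_eq_abs] at this
  linarith

theorem walk_add (α : κ → E) (s : ℝ) {V : Type*} [NormedAddCommGroup V] [NormedSpace ℝ V]
    (g g' : E → V) (x : E) : walk α s (fun y => g y + g' y) x = walk α s g x + walk α s g' x := by
  simp only [walk, ← smul_add, ← Finset.sum_add_distrib]
  congr 1
  exact Finset.sum_congr rfl fun k _ => by abel

theorem walk_map (α : κ → E) (s : ℝ) {V W : Type*} [NormedAddCommGroup V] [NormedSpace ℝ V]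
    [NormedAddCommGroup W] [NormedSpace ℝ W] (T : V →L[ℝ] W) (g : E → V) (x : E) :
    walk α s (fun y => T (g y)) x = T (walk α s g x) := by
  simp [walk, map_sum]

theorem walk_apply (α : κ → E) (s : ℝ) {V W : Type*} [NormedAddCommGroup V] [NormedSpace ℝ V]
    [NormedAddCommGroup W] [NormedSpace ℝ W] (G : E → V →L[ℝ] W) (h : V) (x : E) :
    walk α s G x h = walk α s (fun y => G y h) x :=
  (walk_map α s (ContinuousLinearMap.apply ℝ W h) G x).symm

theorem walk_sub (α : κ → E) (s : ℝ) {V : Type*} [NormedAddCommGroup V] [NormedSpace ℝ V]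
    (g g' : E → V) (x : E) : walk α s (fun y => g y - g' y) x = walk α s g x - walk α s g' x := by
  simp only [walk, ← smul_sub, ← Finset.sum_sub_distrib]
  congr 1
  exact Finset.sum_congr rfl fun k _ => by abel

theorem walk_const_mul (α : κ → E) (s c : ℝ) (g : E → ℝ) (x : E) :
    walk α s (fun y => c * g y) x = c * walk α s g x := by
  simpa using walk_map α s (ContinuousLinearMap.mul ℝ ℝ c) g x

theorem walk_translate (α : κ → E) (s : ℝ) {V : Type*} [NormedAddCommGroup V] [NormedSpace ℝ V]
    (g : E → V) (h x : E) : walk α s (fun y => g (y + h)) x = walk α s g (x + h) := by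
  simp only [walk]
  congr 1
  refine Finset.sum_congr rfl fun k _ => ?_
  rw [add_right_comm, sub_add_eq_add_sub]

/-- A bound for the length of a step of the walk of parameter `1`. -/
def stepBound (α : κ → E) : ℝ := √(Fintype.card κ) * ∑ k, ‖α k‖

theorem norm_step_le (α : κ → E) {s : ℝ} (hs : 0 ≤ s) (k : κ) :
    ‖(s * √(Fintype.card κ)) • α k‖ ≤ stepBound α * s := by
  rw [norm_smul, Real.norm_of_nonneg (by positivity), stepBound]
  have : ‖α k‖ ≤ ∑ k, ‖α k‖ :=
    Finset.single_le_sum (f := fun k => ‖α k‖) (fun _ _ => norm_nonneg _) (Finset.mem_univ k)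
  calc s * √(Fintype.card κ) * ‖α k‖ ≤ s * √(Fintype.card κ) * ∑ k, ‖α k‖ := by gcongr
    _ = _ := by ring

variable [Nonempty κ]

theorem two_card_pos : (0 : ℝ) < 2 * (Fintype.card κ : ℝ) := by
  have : 0 < Fintype.card κ := Fintype.card_pos
  positivity

theorem walk_mono (α : κ → E) (s : ℝ) {g g' : E → ℝ} (h : ∀ x, g x ≤ g' x) (x : E) :
    walk α s g x ≤ walk α s g' x := by
  have := two_card_pos (κ := κ)
  simp only [walk, smul_eq_mul]
  gcongr <;> exact h _

theorem walk_const (α : κ → E) (s : ℝ) {V : Type*} [NormedAddCommGroup V] [NormedSpace ℝ V]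
    (c : V) (x : E) :
    walk α s (fun _ => c) x = c := by
  have := two_card_pos (κ := κ)
  simp only [walk, Finset.sum_const, Finset.card_univ, ← two_nsmul, smul_smul,
    ← Nat.cast_smul_eq_nsmul ℝ]
  convert one_smul ℝ c
  push_cast
  field_simp

theorem norm_walk_le (α : κ → E) (s : ℝ) {V : Type*} [NormedAddCommGroup V] [NormedSpace ℝ V]
    {g : E → V} {c : ℝ} {x : E}
    (h : ∀ k, ‖g (x + (s * √(Fintype.card κ)) • α k)‖ ≤ c ∧
      ‖g (x - (s * √(Fintype.card κ)) • α k)‖ ≤ c) :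
    ‖walk α s g x‖ ≤ c := by
  have h2 := two_card_pos (κ := κ)
  rw [walk, norm_smul, Real.norm_of_nonneg (by positivity)]
  have : ‖∑ k, (g (x + (s * √(Fintype.card κ)) • α k) + g (x - (s * √(Fintype.card κ)) • α k))‖
      ≤ ∑ _k : κ, (c + c) :=
    norm_sum_le_of_le _ fun k _ => norm_add_le_of_le (h k).1 (h k).2
  simp only [Finset.sum_const, Finset.card_univ, nsmul_eq_mul] at this
  calc _ ≤ 1 / (2 * (Fintype.card κ : ℝ)) * ((Fintype.card κ : ℝ) * (c + c)) := by gcongr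
    _ = c := by field_simp; ring

theorem lipschitz_walk (α : κ → E) (s : ℝ) {V : Type*} [NormedAddCommGroup V] [NormedSpace ℝ V]
    {g : E → V} {R : ℝ} (h : ∀ x y, ‖g x - g y‖ ≤ R * ‖x - y‖) (x y : E) :
    ‖walk α s g x - walk α s g y‖ ≤ R * ‖x - y‖ := by
  have e : walk α s g x = walk α s (fun z => g (z + (x - y))) y := by
    rw [walk_translate]; congr 1; abel
  rw [e, ← walk_sub]
  refine norm_walk_le α s fun k => ⟨?_, ?_⟩ <;>
  · refine (h _ _).trans_eq ?_
    simp

theorem norm_walk_sub_self_le (α : κ → E) {s : ℝ} (hs : 0 ≤ s) {V : Type*} [NormedAddCommGroup V]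
    [NormedSpace ℝ V] {g : E → V} {R : ℝ} (hR : 0 ≤ R) (h : ∀ x y, ‖g x - g y‖ ≤ R * ‖x - y‖)
    (x : E) : ‖walk α s g x - g x‖ ≤ R * (stepBound α * s) := by
  rw [← walk_const α s (g x) x, ← walk_sub]
  refine norm_walk_le α s fun k => ⟨?_, ?_⟩ <;>
  · refine (h _ _).trans ?_
    have := norm_step_le α hs k
    simp only [add_sub_cancel_left, sub_sub_cancel_left, norm_neg]
    gcongr

/-- The walk averages translates, so it preserves the constant `K` exactly. Errors therefore do not
worsen under iteration. -/
theorem JetBound.walk {K : ℝ} {g : E → ℝ} {G : E → E →L[ℝ] ℝ}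
    {H : E → E →L[ℝ] E →L[ℝ] ℝ} (hg : JetBound K g G H) (α : κ → E) (s : ℝ) :
    JetBound K (walk α s g) (walk α s G) (walk α s H) where
  symm x v w := by
    simp only [walk_apply, hg.symm _ v w]
  taylor x h := by
    have e2 : 1 / 2 * Corrector.walk α s H x h h
        = Corrector.walk α s (fun y => 1 / 2 * H y h h) x := by
      rw [walk_const_mul, walk_apply, walk_apply]
    rw [walk_apply, e2, ← walk_translate, ← walk_sub, ← walk_sub, ← walk_sub, ← Real.norm_eq_abs]
    exact norm_walk_le α s fun k => ⟨hg.taylor _ _, hg.taylor _ _⟩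
  lip := lipschitz_walk α s hg.lip

/-- The walk with parameter `s` approximates the flow of `secondOrder` for the time `s²`. -/
theorem JetBound.abs_walk_sub_le {K : ℝ} (hK : 0 ≤ K) {g : E → ℝ} {G : E → E →L[ℝ] ℝ}
    {H : E → E →L[ℝ] E →L[ℝ] ℝ} (hg : JetBound K g G H) (α : κ → E) {s : ℝ} (hs : 0 ≤ s)
    (x : E) : |Corrector.walk α s g x - g x - s ^ 2 * secondOrder α (H x)|
      ≤ s ^ 2 * (K * stepBound α ^ 3 * s) := by
  have h2 := two_card_pos (κ := κ)
  have e : Corrector.walk α s g x - g x - s ^ 2 * secondOrder α (H x)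
      = Corrector.walk α s (fun y => g y - g x - G x (y - x) - 1 / 2 * H x (y - x) (y - x)) x := by
    have e1 : Corrector.walk α s (fun y => G x (y - x)) x = 0 := by
      simp [Corrector.walk]
    have e2 : Corrector.walk α s (fun y => 1 / 2 * H x (y - x) (y - x)) x
        = s ^ 2 * secondOrder α (H x) := by
      have hsq : √(Fintype.card κ : ℝ) ^ 2 = Fintype.card κ := Real.sq_sqrt (by positivity)
      simp only [Corrector.walk, secondOrder, add_sub_cancel_left, sub_sub_cancel_left, map_neg,
        map_smul, neg_apply, smul_apply, smul_eq_mul,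
        Finset.mul_sum]
      refine Finset.sum_congr rfl fun k _ => ?_
      field_simp
      rw [hsq]; ring
    rw [walk_sub, walk_sub, walk_sub, e1, e2, walk_const, sub_zero]
  rw [e, ← Real.norm_eq_abs]
  refine (norm_walk_le α s (c := K * (stepBound α * s) ^ 3) fun k => ⟨?_, ?_⟩).trans_eq (by ring)
  · have h := hg.taylor x ((s * √(Fintype.card κ)) • α k)
    rw [add_sub_cancel_left, Real.norm_eq_abs]
    refine h.trans ?_
    have := norm_step_le α hs k
    gcongr
  · have h := hg.taylor x (-((s * √(Fintype.card κ)) • α k))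
    rw [← sub_eq_add_neg, norm_neg] at h
    rw [sub_sub_cancel_left, Real.norm_eq_abs]
    refine h.trans ?_
    have := norm_step_le α hs k
    gcongr

/-- The inner product as a real continuous bilinear form. -/
def innerForm (E : Type*) [NormedAddCommGroup E] [InnerProductSpace ℝ E] :
    E →L[ℝ] E →L[ℝ] ℝ := innerSL ℝ

theorem innerForm_apply (v w : E) : innerForm E v w = inner ℝ v w := rfl

theorem continuous_of_lipschitz {E : Type*} [NormedAddCommGroup E] {g : E → ℝ} {R : ℝ}
    (h : ∀ x y, ‖g x - g y‖ ≤ R * ‖x - y‖) : Continuous g := by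
  refine (LipschitzWith.of_dist_le_mul (K := R.toNNReal) fun x y => ?_).continuous
  rw [dist_eq_norm, dist_eq_norm]
  exact (h x y).trans (by gcongr; exact Real.le_coe_toNNReal R)

/-- A subsolution that lies below `g + τ f` lies below `walk g + (τ + s²) f`, up to a small error:
a version of the implicit Euler scheme. -/
theorem IsLinearSubsolution.le_walk [FiniteDimensional ℝ E] {α : κ → E} {u : E → ℝ}
    {S : E →L[ℝ] E →L[ℝ] ℝ} (hSs : ∀ v w, S v w = S w v) (hS0 : ∀ v, 0 ≤ S v v) {a : ℝ}
    (hu : IsLinearSubsolution α (fun x => 1 / 2 * S x x - a) u) {R : ℝ}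
    (hul : ∀ x y, ‖u x - u y‖ ≤ R * ‖x - y‖) {K : ℝ} (hK : 0 ≤ K) {g : E → ℝ}
    {G : E → E →L[ℝ] ℝ} {H : E → E →L[ℝ] E →L[ℝ] ℝ} (hg : JetBound K g G H)
    (hgl : ∀ x y, ‖g x - g y‖ ≤ R * ‖x - y‖) {τ e s : ℝ} (hτ : 0 ≤ τ) (hs : 0 ≤ s)
    (hle : ∀ x, u x ≤ g x + τ * (1 / 2 * S x x - a) + e) (x : E) :
    u x ≤ walk α s g x + (τ + s ^ 2) * (1 / 2 * S x x - a)
      + (e + s ^ 2 * (K * (stepBound α ^ 3 + (1 / 2 * ∑ k, ‖α k‖ ^ 2) * stepBound α) * s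
        + (τ + s ^ 2) * secondOrder α S)) := by
  set A := 1 / 2 * ∑ k, ‖α k‖ ^ 2 with hA
  have hA0 : 0 ≤ A := by positivity
  set M := stepBound α
  set T := τ + s ^ 2 with hT
  have hT0 : 0 ≤ T := by positivity
  -- The penalty `ε‖x‖²` beats the linear growth of `u` and `walk g`, and `S ≥ 0` has the good sign,
  -- so `u - v` attains its maximum. At the end `ε → 0`.
  have key : ∀ ε : ℝ, 0 < ε → u x ≤ walk α s g x + T * (1 / 2 * S x x - a) + ε * ‖x‖ ^ 2
      + (e + s ^ 2 * (K * (M ^ 3 + A * M) * s + T * secondOrder α S)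
        + s ^ 2 * (2 * ε * secondOrder α (innerForm E))) := by
    intro ε hε
    set v : E → ℝ := fun y => walk α s g y + T * (1 / 2 * S y y - a) + ε * ‖y‖ ^ 2 with hv
    have hwl := lipschitz_walk α s hgl
    have hcont : Continuous fun y => u y - v y := by
      have h1 := continuous_of_lipschitz hul
      have h2 := continuous_of_lipschitz hwl
      simp only [hv]
      fun_prop
    have hbdd : ∀ y, u y - v y ≤ -(ε * ‖y‖ ^ 2 - 2 * R * ‖y‖ - (u 0 - walk α s g 0 + T * a)) := by
      intro y
      have h1 := (abs_le.1 (hul y 0)).2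
      have h2 := (abs_le.1 (hwl y 0)).1
      simp only [sub_zero] at h1 h2
      have h3 := mul_nonneg hT0 (hS0 y)
      simp only [hv]
      nlinarith
    have htend : Tendsto (fun y => u y - v y) (cocompact E) atBot := by
      refine tendsto_atBot_mono hbdd (tendsto_neg_atTop_atBot.comp ?_)
      have hq : Tendsto (fun r : ℝ => ε * r ^ 2 - 2 * R * r - (u 0 - walk α s g 0 + T * a))
          atTop atTop := by
        have : ∀ r : ℝ, ε * r ^ 2 - 2 * R * r - (u 0 - walk α s g 0 + T * a)
          = r * (ε * r - 2 * R) + -(u 0 - walk α s g 0 + T * a) := fun r => by ring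
        simp only [this]
        refine tendsto_atTop_add_const_right _ _ (tendsto_id.atTop_mul_atTop₀ ?_)
        exact tendsto_atTop_add_const_right _ _ (tendsto_id.const_mul_atTop hε)
      exact hq.comp (tendsto_norm_cocompact_atTop)
    obtain ⟨x₀, hx₀⟩ := hcont.exists_forall_ge htend
    have hw := hg.walk α s
    -- Up to a constant, `v` touches `u` from above at `x₀`, so its jet is admissible. This jet
    -- belongs to the updated function, which makes the scheme implicit; replacing `walk H` by `H`
    -- costs `O(K s)`.
    have hjet := hu x₀ (walk α s G x₀ + T • S x₀ + (2 * ε) • innerForm E x₀)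
      (walk α s H x₀ + T • S + (2 * ε) • innerForm E) (fun p q => by
        simp only [add_apply, smul_apply, hw.symm x₀ p q, hSs p q, innerForm_apply,
          real_inner_comm]) (by
        intro θ hθ
        have hnear : ∀ᶠ y in 𝓝 x₀, K * ‖y - x₀‖ ≤ θ := by
          have : Tendsto (fun y => K * ‖y - x₀‖) (𝓝 x₀) (𝓝 (K * ‖x₀ - x₀‖)) := by
            apply Continuous.tendsto; fun_prop
          rw [sub_self, norm_zero, mul_zero] at this
          exact (this.eventually_lt_const hθ).mono fun _ h => h.le
        filter_upwards [hnear] with y hy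
        have h1 := hx₀ y
        have h2 := (abs_le.1 (hw.taylor x₀ (y - x₀))).2
        obtain ⟨z, rfl⟩ : ∃ z, y = x₀ + z := ⟨y - x₀, by abel⟩
        simp only [add_sub_cancel_left] at h2 hy ⊢
        have h3 : ‖x₀ + z‖ ^ 2 = ‖x₀‖ ^ 2 + 2 * inner ℝ x₀ z + ‖z‖ ^ 2 :=
          norm_add_sq_real x₀ z
        have h4 : K * ‖z‖ ^ 3 ≤ θ * ‖z‖ ^ 2 := by
          calc K * ‖z‖ ^ 3 = (K * ‖z‖) * ‖z‖ ^ 2 := by ring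
            _ ≤ _ := by gcongr
        simp only [hv, map_add, add_apply, h3, hSs z x₀] at h1
        simp only [add_apply, smul_apply, smul_eq_mul, innerForm_apply, real_inner_self_eq_norm_sq]
        linarith)
    rw [secondOrder_add, secondOrder_add, secondOrder_smul, secondOrder_smul] at hjet
    have h1 := (abs_le.1 (hg.abs_walk_sub_le hK α hs x₀)).1
    have h2 : |secondOrder α (walk α s H x₀ - H x₀)| ≤ A * (K * (M * s)) :=
      (abs_secondOrder_le α _).trans (by
        gcongr; exact norm_walk_sub_self_le α hs hK hg.lip x₀)
    rw [secondOrder_sub] at h2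
    have h2' := (abs_le.1 h2).2
    -- At `x₀` the assumed bound leaves `-s² f(x₀) - (walk g - g)(x₀)`, which the subsolution
    -- inequality times `s²` controls.
    have h3 := hle x₀
    have h4 := hx₀ x
    have hs2 : 0 ≤ s ^ 2 := by positivity
    have h5 := mul_nonneg hs2 hjet
    have h6 := mul_le_mul_of_nonneg_left h2' hs2
    have h7 : 0 ≤ ε * ‖x₀‖ ^ 2 := by positivity
    simp only [hv] at h4
    simp only [hT] at h4 h5 ⊢
    nlinarith
  refine ge_of_tendsto (x := 𝓝[>] (0 : ℝ)) (f := fun ε : ℝ => walk α s g x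
      + T * (1 / 2 * S x x - a) + ε * ‖x‖ ^ 2
      + (e + s ^ 2 * (K * (M ^ 3 + A * M) * s + T * secondOrder α S)
        + s ^ 2 * (2 * ε * secondOrder α (innerForm E)))) ?_
      (by filter_upwards [self_mem_nhdsWithin] with ε hε using key ε hε)
  refine tendsto_nhdsWithin_of_tendsto_nhds ?_
  have : Continuous fun ε : ℝ => walk α s g x
      + T * (1 / 2 * S x x - a) + ε * ‖x‖ ^ 2
      + (e + s ^ 2 * (K * (M ^ 3 + A * M) * s + T * secondOrder α S)
        + s ^ 2 * (2 * ε * secondOrder α (innerForm E))) := by fun_prop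
  convert this.tendsto 0 using 2
  ring

/-- Iterated version of `IsLinearSubsolution.le_walk`. -/
theorem IsLinearSubsolution.le_iterate_walk [FiniteDimensional ℝ E] {α : κ → E} {u : E → ℝ}
    {S : E →L[ℝ] E →L[ℝ] ℝ} (hSs : ∀ v w, S v w = S w v) (hS0 : ∀ v, 0 ≤ S v v) {a : ℝ}
    (hu : IsLinearSubsolution α (fun x => 1 / 2 * S x x - a) u) {R : ℝ}
    (hul : ∀ x y, ‖u x - u y‖ ≤ R * ‖x - y‖) {K : ℝ} (hK : 0 ≤ K) {g : E → ℝ}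
    {G : E → E →L[ℝ] ℝ} {H : E → E →L[ℝ] E →L[ℝ] ℝ} (hg : JetBound K g G H)
    (hgl : ∀ x y, ‖g x - g y‖ ≤ R * ‖x - y‖) {e s : ℝ} (hs : 0 ≤ s)
    (hle : ∀ x, u x ≤ g x + e) (n : ℕ) (x : E) :
    u x ≤ (walk α s)^[n] g x + (n * s ^ 2) * (1 / 2 * S x x - a)
      + (e + n * s ^ 2 * (K * (stepBound α ^ 3 + (1 / 2 * ∑ k, ‖α k‖ ^ 2) * stepBound α) * s
        + n * s ^ 2 * secondOrder α S)) := by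
  have hc : 0 ≤ secondOrder α S :=
    mul_nonneg (by norm_num) (Finset.sum_nonneg fun k _ => hS0 _)
  have hreg : ∀ n : ℕ, (∃ G' H', JetBound K ((walk α s)^[n] g) G' H') ∧
      ∀ x y, ‖(walk α s)^[n] g x - (walk α s)^[n] g y‖ ≤ R * ‖x - y‖ := by
    intro n
    induction n with
    | zero => exact ⟨⟨G, H, hg⟩, hgl⟩
    | succ n ih =>
      obtain ⟨⟨G', H', h⟩, h'⟩ := ih
      simp only [Function.iterate_succ_apply']
      exact ⟨⟨_, _, h.walk α s⟩, lipschitz_walk α s h'⟩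
  induction n generalizing x with
  | zero => simpa using hle x
  | succ n ih =>
    obtain ⟨⟨G', H', h⟩, h'⟩ := hreg n
    refine (hu.le_walk hSs hS0 hul hK h h' (by positivity) hs ih x).trans ?_
    rw [Function.iterate_succ_apply']
    have hp : 0 ≤ (n : ℝ) * s ^ 2 * (s ^ 2 * secondOrder α S) := by positivity
    push_cast
    nlinarith

/-- The cross terms of the two opposite steps cancel. Squared distances thus propagate exactly,
which makes them the convenient error term under iteration. -/
theorem walk_norm_sub_sq (α : κ → E) (s : ℝ) (x₀ x : E) :
    walk α s (fun y => ‖y - x₀‖ ^ 2) x = ‖x - x₀‖ ^ 2 + s ^ 2 * ∑ k, ‖α k‖ ^ 2 := by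
  have h2 := two_card_pos (κ := κ)
  have hsq : √(Fintype.card κ : ℝ) ^ 2 = Fintype.card κ := Real.sq_sqrt (by positivity)
  have : ∀ k, ‖x + (s * √(Fintype.card κ)) • α k - x₀‖ ^ 2
      + ‖x - (s * √(Fintype.card κ)) • α k - x₀‖ ^ 2
      = 2 * ‖x - x₀‖ ^ 2 + 2 * (s ^ 2 * Fintype.card κ * ‖α k‖ ^ 2) := by
    intro k
    rw [add_sub_right_comm, sub_right_comm, norm_add_sq_real,
      norm_sub_sq_real (x - x₀), norm_smul, mul_pow, Real.norm_eq_abs, sq_abs, mul_pow, hsq]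
    ring
  simp only [walk, this, Finset.sum_add_distrib, Finset.sum_const, Finset.card_univ, nsmul_eq_mul,
    smul_eq_mul, ← Finset.mul_sum]
  field_simp

/-- Upper bound for the iterated walk applied to a function with a bounded jet. -/
theorem JetBound.iterate_walk_le {K : ℝ} (hK : 0 ≤ K) {h : E → ℝ} {G : E → E →L[ℝ] ℝ}
    {H : E → E →L[ℝ] E →L[ℝ] ℝ} (hh : JetBound K h G H) (α : κ → E) {s : ℝ} (hs : 0 ≤ s) (x₀ : E)
    {η : ℝ} (hη : 0 < η) (n : ℕ) (x : E) :
    (Corrector.walk α s)^[n] h x ≤ h x + n * s ^ 2 * (secondOrder α (H x₀)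
      + (1 / 2 * ∑ k, ‖α k‖ ^ 2) * K * η + K * stepBound α ^ 3 * s)
      + (1 / 2 * ∑ k, ‖α k‖ ^ 2) * K / η * (n * s ^ 2 * ‖x - x₀‖ ^ 2
        + (n * s ^ 2) ^ 2 * ∑ k, ‖α k‖ ^ 2) := by
  set S₂ := ∑ k, ‖α k‖ ^ 2 with hS₂
  have hS0 : 0 ≤ S₂ := by positivity
  set A := 1 / 2 * S₂
  have hA0 : 0 ≤ A := by positivity
  have hone : ∀ y, Corrector.walk α s h y ≤ h y + s ^ 2 * (secondOrder α (H x₀)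
      + A * K * η + K * stepBound α ^ 3 * s) + A * K / η * (s ^ 2 * ‖y - x₀‖ ^ 2) := by
    intro y
    have h1 := (abs_le.1 (hh.abs_walk_sub_le hK α hs y)).2
    have h2 : |secondOrder α (H y - H x₀)| ≤ A * (K * ‖y - x₀‖) :=
      (abs_secondOrder_le α _).trans (by gcongr; exact hh.lip y x₀)
    rw [secondOrder_sub] at h2
    have h2' := (abs_le.1 h2).2
    -- The Lipschitz error of the Hessian is linear in the distance; it is traded for a quadratic,
    -- which the walk propagates exactly.
    have h3 : ‖y - x₀‖ ≤ η + ‖y - x₀‖ ^ 2 / η := by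
      have := sq_nonneg (‖y - x₀‖ - η)
      have hn := norm_nonneg (y - x₀)
      rw [← sub_nonneg]
      have e : η + ‖y - x₀‖ ^ 2 / η - ‖y - x₀‖
        = ((‖y - x₀‖ - η) ^ 2 + ‖y - x₀‖ * η) / η := by field_simp; ring
      rw [e]; positivity
    have h4 : A * (K * ‖y - x₀‖) ≤ A * K * η + A * K / η * ‖y - x₀‖ ^ 2 := by
      calc A * (K * ‖y - x₀‖) ≤ A * (K * (η + ‖y - x₀‖ ^ 2 / η)) := by gcongr
        _ = _ := by ring
    have hs2 : 0 ≤ s ^ 2 := by positivity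
    have h5 := mul_le_mul_of_nonneg_left (h2'.trans h4) hs2
    linarith
  induction n generalizing x with
  | zero => simp
  | succ n ih =>
    rw [Function.iterate_succ_apply']
    refine (walk_mono α s ih x).trans ?_
    rw [walk_add, walk_add, walk_const, walk_const_mul, walk_add, walk_const, walk_const_mul,
      walk_norm_sub_sq]
    have h1 := hone x
    have hp : 0 ≤ A * K / η * (s ^ 2 * s ^ 2 * (n + 1) * S₂) := by positivity
    push_cast
    nlinarith

theorem iterate_walk_le_add (α : κ → E) (s : ℝ) {g g' : E → ℝ} {c : ℝ}
    (h : ∀ x, g x ≤ g' x + c) (n : ℕ) (x : E) :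
    (walk α s)^[n] g x ≤ (walk α s)^[n] g' x + c := by
  induction n generalizing x with
  | zero => exact h x
  | succ n ih =>
    simp only [Function.iterate_succ_apply']
    refine (walk_mono α s ih x).trans_eq ?_
    rw [walk_add, walk_const]

end Walk

/-! ### Mollification of Lipschitz functions and of linear subsolutions -/

section Mollify

open MeasureTheory

variable {E : Type*} [NormedAddCommGroup E] [InnerProductSpace ℝ E]

/-- The mean value inequality on the ball of radius `‖h‖` about `x` is applied twice: to `G` minus
its linearisation, then to `g` minus its quadratic part. -/
theorem jetBound_of_hasFDerivAt {K : ℝ} {g : E → ℝ} {G : E → E →L[ℝ] ℝ}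
    {H : E → E →L[ℝ] E →L[ℝ] ℝ} (hG : ∀ x, HasFDerivAt g (G x) x)
    (hH : ∀ x, HasFDerivAt G (H x) x) (hK : 0 ≤ K) (hl : ∀ x y, ‖H x - H y‖ ≤ K * ‖x - y‖) :
    JetBound K g G H where
  symm x := second_derivative_symmetric hG (hH x)
  lip := hl
  taylor x h := by
    have hsymm := second_derivative_symmetric hG (hH x)
    have hconv : Convex ℝ (Metric.closedBall x ‖h‖) := convex_closedBall x ‖h‖
    have hx : x ∈ Metric.closedBall x ‖h‖ := Metric.mem_closedBall_self (norm_nonneg h)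
    have hxh : x + h ∈ Metric.closedBall x ‖h‖ := by simp
    have h1 : ∀ y ∈ Metric.closedBall x ‖h‖, ‖G y - H x (y - x) - G x‖ ≤ K * ‖h‖ ^ 2 := by
      intro y hy
      have hyn : ‖y - x‖ ≤ ‖h‖ := by rwa [← dist_eq_norm]
      have := hconv.norm_image_sub_le_of_norm_hasFDerivWithin_le' (𝕜 := ℝ) (f := G) (f' := H)
        (φ := H x) (C := K * ‖h‖) (fun z _ => (hH z).hasFDerivWithinAt) (fun z hz => by
          refine (hl z x).trans ?_
          have : ‖z - x‖ ≤ ‖h‖ := by rwa [← dist_eq_norm]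
          gcongr) hx hy
      rw [sub_right_comm]
      calc _ ≤ _ := this
        _ ≤ K * ‖h‖ * ‖h‖ := by gcongr
        _ = _ := by ring
    have h2 : ∀ y, HasFDerivAt (fun y => g y - 1 / 2 * H x (y - x) (y - x))
        (G y - H x (y - x)) y := by
      intro y
      have hid : HasFDerivAt (fun y : E => y - x) (ContinuousLinearMap.id ℝ E) y :=
        (hasFDerivAt_id y).sub_const x
      have hb := ((H x).hasFDerivAt_of_bilinear hid hid).const_mul (1 / 2)
      refine ((hG y).sub hb).congr_fderiv ?_
      ext v
      have := hsymm v (y - x)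
      simp only [sub_apply, smul_apply, add_apply, ContinuousLinearMap.precompR_apply,
        ContinuousLinearMap.precompL_apply, ContinuousLinearMap.compL_apply,
        ContinuousLinearMap.comp_id, ContinuousLinearMap.id_apply, this, smul_eq_mul]
      ring
    have h3 := hconv.norm_image_sub_le_of_norm_hasFDerivWithin_le' (𝕜 := ℝ)
      (φ := G x) (C := K * ‖h‖ ^ 2) (fun z _ => (h2 z).hasFDerivWithinAt) h1 hx hxh
    simp only [add_sub_cancel_left, sub_self, map_zero, mul_zero, sub_zero,
      Real.norm_eq_abs] at h3
    calc _ = |g (x + h) - 1 / 2 * H x h h - g x - G x h| := by congr 1; ring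
      _ ≤ _ := h3
      _ = _ := by ring

theorem JetBound.apply_le {K : ℝ} {g : E → ℝ} {G : E → E →L[ℝ] ℝ} {H : E → E →L[ℝ] E →L[ℝ] ℝ}
    (hg : JetBound K g G H) {v x : E} {c : ℝ}
    (h : ∀ t : ℝ, 0 < t → g (x + t • v) ≤ g x + t * c) : G x v ≤ c := by
  have key : ∀ t : ℝ, 0 < t → G x v ≤ c - t * (1 / 2 * H x v v) + t ^ 2 * (K * ‖v‖ ^ 3) := by
    intro t ht
    have h1 := (abs_le.1 (hg.taylor x (t • v))).1
    have h2 := h t ht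
    simp only [map_smul, smul_apply, smul_eq_mul, norm_smul, Real.norm_eq_abs, abs_of_pos ht,
      mul_pow] at h1
    have h3 : t * G x v ≤ t * (c - t * (1 / 2 * H x v v) + t ^ 2 * (K * ‖v‖ ^ 3)) := by
      linarith
    exact le_of_mul_le_mul_left h3 ht
  refine ge_of_tendsto (x := 𝓝[>] (0 : ℝ))
    (f := fun t : ℝ => c - t * (1 / 2 * H x v v) + t ^ 2 * (K * ‖v‖ ^ 3)) ?_
    (by filter_upwards [self_mem_nhdsWithin] with t ht using key t ht)
  refine tendsto_nhdsWithin_of_tendsto_nhds ?_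
  have : Continuous fun t : ℝ => c - t * (1 / 2 * H x v v) + t ^ 2 * (K * ‖v‖ ^ 3) := by fun_prop
  convert this.tendsto 0 using 2
  ring

variable [FiniteDimensional ℝ E] [MeasurableSpace E] [BorelSpace E]

/-- A continuous probability density supported in the ball of radius `r`. -/
structure IsMollifier (r : ℝ) (φ : E → ℝ) : Prop where
  continuous : Continuous φ
  hasCompactSupport : HasCompactSupport φ
  nonneg : ∀ z, 0 ≤ φ z
  integral_eq_one : ∫ z, φ z = 1
  norm_le : ∀ z, φ z ≠ 0 → ‖z‖ ≤ r

/-- The convolution of `u` with the density `φ`. -/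
def mollify (φ u : E → ℝ) (x : E) : ℝ := ∫ z, φ z * u (x - z)

variable {r : ℝ} {φ : E → ℝ}

theorem IsMollifier.integrable (hφ : IsMollifier r φ) {u : E → ℝ} (hu : Continuous u) (x : E) :
    Integrable fun z => φ z * u (x - z) := by
  have := hφ.continuous
  exact Continuous.integrable_of_hasCompactSupport (by fun_prop) hφ.hasCompactSupport.mul_right

theorem IsMollifier.mollify_const (hφ : IsMollifier r φ) (c : ℝ) (x : E) :
    mollify φ (fun _ => c) x = c := by
  simp [mollify, integral_mul_const, hφ.integral_eq_one]

theorem IsMollifier.mollify_le_mollify (hφ : IsMollifier r φ) {u v : E → ℝ} (hu : Continuous u)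
    (hv : Continuous v) {x y : E} (h : ∀ z, ‖z‖ ≤ r → u (x - z) ≤ v (y - z)) :
    mollify φ u x ≤ mollify φ v y := by
  refine integral_mono (hφ.integrable hu x) (hφ.integrable hv y) fun z => ?_
  by_cases hz : φ z = 0
  · simp [hz]
  · exact mul_le_mul_of_nonneg_left (h z (hφ.norm_le z hz)) (hφ.nonneg z)

theorem IsMollifier.mollify_add (hφ : IsMollifier r φ) {u v : E → ℝ} (hu : Continuous u)
    (hv : Continuous v) (x : E) :
    mollify φ (fun y => u y + v y) x = mollify φ u x + mollify φ v x := by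
  simp only [mollify, mul_add]
  exact integral_add (hφ.integrable hu x) (hφ.integrable hv x)

theorem mollify_const_mul (c : ℝ) (u : E → ℝ) (x : E) :
    mollify φ (fun y => c * u y) x = c * mollify φ u x := by
  simp only [mollify, ← integral_const_mul]
  congr 1; ext z; ring

theorem IsMollifier.mollify_le_add (hφ : IsMollifier r φ) {u : E → ℝ} (hu : Continuous u)
    {x y : E} {c : ℝ} (h : ∀ z, u (x - z) ≤ u (y - z) + c) :
    mollify φ u x ≤ mollify φ u y + c := by
  calc mollify φ u x ≤ mollify φ (fun z => u z + c) y :=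
        hφ.mollify_le_mollify hu (by fun_prop) fun z _ => h z
    _ = _ := by rw [hφ.mollify_add hu continuous_const, hφ.mollify_const]

theorem IsMollifier.abs_mollify_sub_le (hφ : IsMollifier r φ) {u : E → ℝ} {R : ℝ} (hR : 0 ≤ R)
    (hu : ∀ x y, ‖u x - u y‖ ≤ R * ‖x - y‖) (x : E) : |mollify φ u x - u x| ≤ R * r := by
  have hc := continuous_of_lipschitz hu
  have hb : ∀ z, ‖z‖ ≤ r → |u (x - z) - u x| ≤ R * r := fun z hz => by
    refine (hu _ _).trans ?_
    rw [sub_sub_cancel_left, norm_neg]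
    gcongr
  rw [abs_le]
  constructor
  · have := hφ.mollify_le_mollify (u := fun _ => u x - R * r) (v := u) (x := x) (y := x)
      continuous_const hc fun z hz => by have := (abs_le.1 (hb z hz)).1; linarith
    rw [hφ.mollify_const] at this
    linarith
  · have := hφ.mollify_le_mollify (u := u) (v := fun _ => u x + R * r) (x := x) (y := x)
      hc continuous_const fun z hz => by have := (abs_le.1 (hb z hz)).2; linarith
    rw [hφ.mollify_const] at this
    linarith

theorem IsMollifier.lipschitz_mollify (hφ : IsMollifier r φ) {u : E → ℝ} {R : ℝ}
    (hu : ∀ x y, ‖u x - u y‖ ≤ R * ‖x - y‖) (x y : E) :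
    ‖mollify φ u x - mollify φ u y‖ ≤ R * ‖x - y‖ := by
  have hc := continuous_of_lipschitz hu
  have key : ∀ x y, mollify φ u x ≤ mollify φ u y + R * ‖x - y‖ := fun x y =>
    hφ.mollify_le_add hc fun z => by
      have := (abs_le.1 (hu (x - z) (y - z))).2
      rw [sub_sub_sub_cancel_right] at this
      linarith
  have h1 := key x y
  have h2 := key y x
  rw [norm_sub_rev] at h2
  exact abs_le.2 ⟨by linarith, by linarith⟩

section

variable {κ : Type*} [Fintype κ]

theorem IsMollifier.mollify_walk (hφ : IsMollifier r φ) (α : κ → E) (s : ℝ) {u : E → ℝ}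
    (hu : Continuous u) (x : E) : mollify φ (walk α s u) x = walk α s (mollify φ u) x := by
  simp only [mollify, walk, smul_eq_mul, Finset.mul_sum]
  have h : ∀ (k : κ) (z : E), φ z * (1 / (2 * (Fintype.card κ : ℝ)) *
      (u (x - z + (s * √(Fintype.card κ)) • α k) + u (x - z - (s * √(Fintype.card κ)) • α k)))
      = 1 / (2 * (Fintype.card κ : ℝ)) * (φ z * u (x + (s * √(Fintype.card κ)) • α k - z)
        + φ z * u (x - (s * √(Fintype.card κ)) • α k - z)) := by
    intro k z
    rw [sub_add_eq_add_sub, sub_right_comm]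
    ring
  simp only [h]
  rw [integral_finsetSum]
  swap
  · exact fun k _ => ((hφ.integrable hu _).add (hφ.integrable hu _)).const_mul _
  refine Finset.sum_congr rfl fun k _ => ?_
  rw [integral_const_mul, integral_add (hφ.integrable hu _) (hφ.integrable hu _)]

theorem continuous_walk {E : Type*} [NormedAddCommGroup E] [InnerProductSpace ℝ E]
    (α : κ → E) (s : ℝ) {u : E → ℝ} (hu : Continuous u) :
    Continuous (walk α s u) := by
  unfold walk; fun_prop

theorem continuous_iterate_walk {E : Type*} [NormedAddCommGroup E] [InnerProductSpace ℝ E]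
    (α : κ → E) (s : ℝ) {u : E → ℝ} (hu : Continuous u) (n : ℕ) :
    Continuous ((walk α s)^[n] u) := by
  induction n with
  | zero => exact hu
  | succ n ih => rw [Function.iterate_succ_apply']; exact continuous_walk α s ih

theorem IsMollifier.mollify_iterate_walk (hφ : IsMollifier r φ) (α : κ → E) (s : ℝ) {u : E → ℝ}
    (hu : Continuous u) (n : ℕ) (x : E) :
    mollify φ ((walk α s)^[n] u) x = (walk α s)^[n] (mollify φ u) x := by
  induction n generalizing x with
  | zero => rfl
  | succ n ih =>
    rw [Function.iterate_succ_apply', Function.iterate_succ_apply',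
      hφ.mollify_walk α s (continuous_iterate_walk α s hu n)]
    congr 1
    exact funext ih

end

/-- The increment falls on the Lipschitz factor `u`, so `f` need only be integrable. With `f` the
second derivative of a bump this bounds the variation of the Hessian of a mollification. -/
theorem exists_lipschitz_convolution {F W : Type*} [NormedAddCommGroup F] [NormedSpace ℝ F]
    [NormedAddCommGroup W] [NormedSpace ℝ W] (L : F →L[ℝ] ℝ →L[ℝ] W) {f : E → F}
    (hf : Continuous f) (hfc : HasCompactSupport f) {u : E → ℝ} {R : ℝ}
    (hR : 0 ≤ R) (hu : ∀ x y, ‖u x - u y‖ ≤ R * ‖x - y‖) :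
    ∃ K : ℝ, 0 ≤ K ∧ ∀ x y,
      ‖convolution f u L volume x - convolution f u L volume y‖ ≤ K * ‖x - y‖ := by
  have hc := continuous_of_lipschitz hu
  have hint : ∀ x, Integrable fun z => L (f z) (u (x - z)) := fun x => by
    refine Continuous.integrable_of_hasCompactSupport (by fun_prop) (hfc.mono fun z hz => ?_)
    contrapose! hz
    simp_all
  have hfi : Integrable fun z => ‖f z‖ := (hf.integrable_of_hasCompactSupport hfc).norm
  refine ⟨‖L‖ * R * ∫ z, ‖f z‖, by positivity, fun x y => ?_⟩
  simp only [convolution]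
  rw [← integral_sub (hint x) (hint y)]
  have : (‖L‖ * R * ∫ z, ‖f z‖) * ‖x - y‖ = ∫ z, ‖f z‖ * (‖L‖ * R * ‖x - y‖) := by
    rw [integral_mul_const]; ring
  rw [this]
  refine norm_integral_le_of_norm_le (hfi.mul_const _) (Eventually.of_forall fun z => ?_)
  rw [← map_sub]
  have h := hu (x - z) (y - z)
  rw [sub_sub_sub_cancel_right] at h
  calc _ ≤ ‖L‖ * ‖f z‖ * ‖u (x - z) - u (y - z)‖ := L.le_opNorm₂ _ _
    _ ≤ ‖L‖ * ‖f z‖ * (R * ‖x - y‖) := by gcongr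
    _ = _ := by ring

/-- There are mollifiers of arbitrarily small support that turn Lipschitz functions into functions
with bounded jets. -/
theorem exists_isMollifier (E : Type*) [NormedAddCommGroup E] [InnerProductSpace ℝ E]
    [FiniteDimensional ℝ E] [MeasurableSpace E] [BorelSpace E] {r : ℝ} (hr : 0 < r) :
    ∃ φ : E → ℝ, IsMollifier r φ ∧
      ∀ (u : E → ℝ) (R : ℝ), 0 ≤ R → (∀ x y, ‖u x - u y‖ ≤ R * ‖x - y‖) →
        ∃ (K : ℝ) (G : E → E →L[ℝ] ℝ) (H : E → E →L[ℝ] E →L[ℝ] ℝ), 0 ≤ K ∧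
          JetBound K (mollify φ u) G H := by
  let b : ContDiffBump (0 : E) := ⟨r / 2, r, by positivity, by linarith⟩
  have hsm : ContDiff ℝ 2 (b.normed volume) := b.contDiff_normed
  have hcs : HasCompactSupport (b.normed volume) := b.hasCompactSupport_normed
  refine ⟨b.normed volume, ⟨hsm.continuous, hcs, b.nonneg_normed, b.integral_normed, ?_⟩, ?_⟩
  · intro z hz
    have : z ∈ Function.support (b.normed volume) := hz
    rw [b.support_normed_eq, mem_ball_zero_iff] at this
    exact this.le
  · intro u R hR hu
    have hc := (continuous_of_lipschitz hu).locallyIntegrable (μ := (volume : Measure E))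
    have hd : ContDiff ℝ 1 (fderiv ℝ (b.normed (volume : Measure E))) :=
      hsm.fderiv_right (by norm_num)
    have h1 := hcs.hasFDerivAt_convolution_left (ContinuousLinearMap.lsmul ℝ ℝ)
      (hsm.of_le (by norm_num)) hc
    have h2 := (hcs.fderiv ℝ).hasFDerivAt_convolution_left
      ((ContinuousLinearMap.lsmul ℝ ℝ).precompL E) hd hc
    obtain ⟨K, hK, h3⟩ := exists_lipschitz_convolution (W := E →L[ℝ] E →L[ℝ] ℝ)
      (((ContinuousLinearMap.lsmul ℝ ℝ : ℝ →L[ℝ] ℝ →L[ℝ] ℝ).precompL E).precompL E)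
      (hd.continuous_fderiv (by norm_num)) ((hcs.fderiv ℝ).fderiv ℝ) hR hu
    have hm : mollify (b.normed volume) u
        = convolution (b.normed volume) u (ContinuousLinearMap.lsmul ℝ ℝ) volume := rfl
    rw [hm]
    exact ⟨K, _, _, hK, jetBound_of_hasFDerivAt h1 h2 hK h3⟩

/-- The mollification of a viscosity subsolution of a linear equation with constant coefficients
is a classical subsolution of the mollified equation. -/
theorem IsLinearSubsolution.mollify_le {κ : Type*} [Fintype κ] [Nonempty κ] {α : κ → E} {u : E → ℝ}
    {S : E →L[ℝ] E →L[ℝ] ℝ} (hSs : ∀ v w, S v w = S w v) (hS0 : ∀ v, 0 ≤ S v v) {a : ℝ}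
    (hu : IsLinearSubsolution α (fun x => 1 / 2 * S x x - a) u) {R : ℝ} (hR : 0 ≤ R)
    (hul : ∀ x y, ‖u x - u y‖ ≤ R * ‖x - y‖) (hφ : IsMollifier r φ) {K : ℝ} (hK : 0 ≤ K)
    {G : E → E →L[ℝ] ℝ} {H : E → E →L[ℝ] E →L[ℝ] ℝ} (hj : JetBound K (mollify φ u) G H) (x : E) :
    0 ≤ mollify φ (fun x => 1 / 2 * S x x - a) x + secondOrder α (H x) := by
  set f : E → ℝ := fun x => 1 / 2 * S x x - a with hf
  have hfc : Continuous f := by simp only [hf]; fun_prop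
  have huc := continuous_of_lipschitz hul
  set S₂ := ∑ k, ‖α k‖ ^ 2 with hS₂
  set A := 1 / 2 * S₂ with hA
  set M := stepBound α
  set c := secondOrder α S
  set ℓ := secondOrder α (H x)
  -- the inequality at scale `ρ`, time `θ²` and `n` steps
  have main : ∀ ρ : ℝ, 0 < ρ → ∃ C : ℝ, ∀ θ : ℝ, 0 < θ → ∀ n : ℕ, 0 < n →
      0 ≤ 2 * (R * ρ) + θ ^ 2 * (mollify φ f x + ℓ + A * K * θ + A * K * S₂ * θ + θ ^ 2 * c
        + C * (θ / √n)) := by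
    intro ρ hρ
    obtain ⟨ψ, hψ, hψj⟩ := exists_isMollifier E hρ
    obtain ⟨K', G', H', hK', hj'⟩ := hψj u R hR hul
    refine ⟨K' * (M ^ 3 + A * M) + K * M ^ 3, fun θ hθ n hn => ?_⟩
    have hn' : (0 : ℝ) < n := by exact_mod_cast hn
    set s := θ / √n with hs
    have hs0 : 0 ≤ s := by positivity
    have hns : n * s ^ 2 = θ ^ 2 := by
      rw [hs, div_pow, Real.sq_sqrt hn'.le]; field_simp
    have hclose := hψ.abs_mollify_sub_le hR hul
    -- The scheme needs a smooth start, so it starts from an auxiliary mollification at scale `ρ`.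
    -- Leaving `u` and returning to it costs `R ρ` each, whence `2 R ρ`.
    have h1 := hu.le_iterate_walk hSs hS0 hul hK' hj' (hψ.lipschitz_mollify hul) hs0
      (e := R * ρ) (fun y => by have := (abs_le.1 (hclose y)).1; linarith) n
    have h2 : ∀ y, u y ≤ (walk α s)^[n] u y + (n * s ^ 2 * f y + (2 * (R * ρ) +
        n * s ^ 2 * (K' * (M ^ 3 + A * M) * s + n * s ^ 2 * c))) := fun y => by
      have h3 := iterate_walk_le_add α s (g := mollify ψ u) (g' := u) (c := R * ρ)
        (fun y => by have := (abs_le.1 (hclose y)).2; linarith) n y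
      have h4 := h1 y
      rw [← hS₂, ← hA] at h4
      simp only [hf]
      linarith
    have hwc := continuous_iterate_walk α s huc n
    -- The viscosity inequality is now a pointwise one and can be integrated against `φ`; the walk
    -- then moves onto `mollify φ u`, whose `K` does not depend on `ρ`.
    have h5 := hφ.mollify_le_mollify (x := x) (y := x) (v := fun y => (walk α s)^[n] u y
        + (n * s ^ 2 * f y + (2 * (R * ρ) + n * s ^ 2 * (K' * (M ^ 3 + A * M) * s
          + n * s ^ 2 * c)))) huc (by fun_prop) fun z _ => h2 (x - z)
    rw [hφ.mollify_add hwc (by fun_prop), hφ.mollify_add (by fun_prop) (by fun_prop),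
      mollify_const_mul, hφ.mollify_const, hφ.mollify_iterate_walk α s huc] at h5
    have h6 := hj.iterate_walk_le hK α hs0 x hθ n x
    rw [sub_self, norm_zero, ← hS₂, ← hA] at h6
    simp only [hns] at h5 h6
    have e : A * K / θ * (θ ^ 2 * 0 ^ 2 + (θ ^ 2) ^ 2 * S₂) = θ ^ 2 * (A * K * S₂ * θ) := by
      field_simp; ring
    rw [e] at h6
    linarith
  -- The order of limits matters: `C` depends on `ρ` without control, so `n → ∞` comes first. Then
  -- `ρ → 0` removes the start-up error before dividing by `θ²`, and `θ → 0` comes last.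
  have hlim1 : ∀ ρ : ℝ, 0 < ρ → ∀ θ : ℝ, 0 < θ →
      0 ≤ 2 * (R * ρ) + θ ^ 2 * (mollify φ f x + ℓ + A * K * θ + A * K * S₂ * θ + θ ^ 2 * c) := by
    intro ρ hρ θ hθ
    obtain ⟨C, hC⟩ := main ρ hρ
    have ht : Tendsto (fun n : ℕ => θ / √(n : ℝ)) atTop (𝓝 0) :=
      tendsto_const_nhds.div_atTop (Real.tendsto_sqrt_atTop.comp tendsto_natCast_atTop_atTop)
    refine ge_of_tendsto (x := atTop) (f := fun n : ℕ => 2 * (R * ρ) + θ ^ 2 * (mollify φ f x + ℓ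
      + A * K * θ + A * K * S₂ * θ + θ ^ 2 * c + C * (θ / √n))) ?_
      ((eventually_gt_atTop 0).mono fun n hn => hC θ hθ n hn)
    have := ((ht.const_mul C).const_add (mollify φ f x + ℓ + A * K * θ + A * K * S₂ * θ
      + θ ^ 2 * c)).const_mul (θ ^ 2) |>.const_add (2 * (R * ρ))
    simpa using this
  have hlim2 : ∀ θ : ℝ, 0 < θ →
      0 ≤ mollify φ f x + ℓ + A * K * θ + A * K * S₂ * θ + θ ^ 2 * c := by
    intro θ hθ
    refine nonneg_of_mul_nonneg_right (a := θ ^ 2) ?_ (by positivity)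
    refine ge_of_tendsto (x := 𝓝[>] (0 : ℝ)) (f := fun ρ : ℝ => 2 * (R * ρ)
      + θ ^ 2 * (mollify φ f x + ℓ + A * K * θ + A * K * S₂ * θ + θ ^ 2 * c)) ?_
      (by filter_upwards [self_mem_nhdsWithin] with ρ hρ using hlim1 ρ hρ θ hθ)
    refine tendsto_nhdsWithin_of_tendsto_nhds ?_
    have : Continuous fun ρ : ℝ => 2 * (R * ρ)
      + θ ^ 2 * (mollify φ f x + ℓ + A * K * θ + A * K * S₂ * θ + θ ^ 2 * c) := by fun_prop
    convert this.tendsto 0 using 2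
    ring
  refine ge_of_tendsto (x := 𝓝[>] (0 : ℝ)) (f := fun θ : ℝ => mollify φ f x + ℓ + A * K * θ
    + A * K * S₂ * θ + θ ^ 2 * c) ?_
    (by filter_upwards [self_mem_nhdsWithin] with θ hθ using hlim2 θ hθ)
  refine tendsto_nhdsWithin_of_tendsto_nhds ?_
  have : Continuous fun θ : ℝ => mollify φ f x + ℓ + A * K * θ + A * K * S₂ * θ + θ ^ 2 * c := by
    fun_prop
  convert this.tendsto 0 using 2
  ring

end Mollify

/-! ### Dictionary between matrices and bilinear forms, vectors and linear forms -/

section Jets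

variable {d : ℕ}

/-- The matrix of a bilinear form in the standard basis. -/
def formMatrix (B : EuclideanSpace ℝ (Fin d) →L[ℝ] EuclideanSpace ℝ (Fin d) →L[ℝ] ℝ) :
    Matrix (Fin d) (Fin d) ℝ :=
  Matrix.of fun i j => B (EuclideanSpace.single i 1) (EuclideanSpace.single j 1)

/-- The columns of a matrix, as vectors. -/
def column (M : Matrix (Fin d) (Fin d) ℝ) (k : Fin d) : EuclideanSpace ℝ (Fin d) :=
  WithLp.toLp 2 fun i => M i k

theorem eq_sum_single (v : EuclideanSpace ℝ (Fin d)) :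
    v = ∑ i, v i • EuclideanSpace.single i (1 : ℝ) := by
  ext j
  simp [Finset.sum_apply, Pi.single_apply]

theorem form_eq_sum (B : EuclideanSpace ℝ (Fin d) →L[ℝ] EuclideanSpace ℝ (Fin d) →L[ℝ] ℝ)
    (v w : EuclideanSpace ℝ (Fin d)) : B v w = ∑ i, ∑ j, v i * w j * formMatrix B i j := by
  conv_lhs => rw [eq_sum_single v, eq_sum_single w]
  simp only [map_sum, map_smul, sum_apply, smul_apply, smul_eq_mul, formMatrix, Matrix.of_apply,
    Finset.mul_sum]
  rw [Finset.sum_comm]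
  exact Finset.sum_congr rfl fun i _ => Finset.sum_congr rfl fun j _ => by ring

theorem formMatrix_isSymm
    {B : EuclideanSpace ℝ (Fin d) →L[ℝ] EuclideanSpace ℝ (Fin d) →L[ℝ] ℝ}
    (hB : ∀ v w, B v w = B w v) : (formMatrix B).IsSymm := by
  ext i j
  simp only [formMatrix, Matrix.transpose_apply, Matrix.of_apply, hB]

theorem inner_formMatrix (B : EuclideanSpace ℝ (Fin d) →L[ℝ] EuclideanSpace ℝ (Fin d) →L[ℝ] ℝ)
    (v : EuclideanSpace ℝ (Fin d)) :
    inner ℝ (Matrix.toEuclideanLin (formMatrix B) v) v = B v v := by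
  rw [form_eq_sum]
  simp only [PiLp.inner_apply, Matrix.toLpLin_apply, Matrix.mulVec, dotProduct,
    RCLike.inner_apply, conj_trivial, Finset.mul_sum]
  exact Finset.sum_congr rfl fun i _ => Finset.sum_congr rfl fun j _ => by ring

/-- This is what lets the columns of `ᾱ` serve as the directions of the walk. -/
theorem trace_formMatrix (M : Matrix (Fin d) (Fin d) ℝ)
    (B : EuclideanSpace ℝ (Fin d) →L[ℝ] EuclideanSpace ℝ (Fin d) →L[ℝ] ℝ) :
    1 / 2 * (M * M.transpose * formMatrix B).trace = secondOrder (column M) B := by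
  simp only [secondOrder, form_eq_sum B, Matrix.trace, Matrix.diag, Matrix.mul_apply,
    Matrix.transpose_apply, column, Finset.sum_mul]
  congr 1
  calc _ = ∑ i, ∑ k, ∑ j, M i k * M j k * formMatrix B j i :=
        Finset.sum_congr rfl fun i _ => Finset.sum_comm
    _ = ∑ k, ∑ i, ∑ j, M i k * M j k * formMatrix B j i := Finset.sum_comm
    _ = _ := Finset.sum_congr rfl fun k _ => by
      rw [Finset.sum_comm]
      exact Finset.sum_congr rfl fun i _ => Finset.sum_congr rfl fun j _ => by ring

/-- The vector representing a linear form. -/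
def gradient (p : EuclideanSpace ℝ (Fin d) →L[ℝ] ℝ) : EuclideanSpace ℝ (Fin d) :=
  (InnerProductSpace.toDual ℝ _).symm p

theorem inner_gradient (p : EuclideanSpace ℝ (Fin d) →L[ℝ] ℝ) (v : EuclideanSpace ℝ (Fin d)) :
    inner ℝ (gradient p) v = p v :=
  InnerProductSpace.toDual_symm_apply

theorem mem_superjet {u : EuclideanSpace ℝ (Fin d) → ℝ} {x : EuclideanSpace ℝ (Fin d)}
    {p : EuclideanSpace ℝ (Fin d) →L[ℝ] ℝ}
    {B : EuclideanSpace ℝ (Fin d) →L[ℝ] EuclideanSpace ℝ (Fin d) →L[ℝ] ℝ}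
    (hB : ∀ v w, B v w = B w v) (h : ∀ ε : ℝ, 0 < ε → ∀ᶠ y in 𝓝 x,
      u y ≤ u x + p (y - x) + 1 / 2 * B (y - x) (y - x) + ε * ‖y - x‖ ^ 2) :
    (gradient p, formMatrix B) ∈ superjet u x :=
  ⟨formMatrix_isSymm hB, fun ε hε => by simpa only [inner_gradient, inner_formMatrix] using h ε hε⟩

theorem mem_subjet {u : EuclideanSpace ℝ (Fin d) → ℝ} {x : EuclideanSpace ℝ (Fin d)}
    {p : EuclideanSpace ℝ (Fin d) →L[ℝ] ℝ}
    {B : EuclideanSpace ℝ (Fin d) →L[ℝ] EuclideanSpace ℝ (Fin d) →L[ℝ] ℝ}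
    (hB : ∀ v w, B v w = B w v) (h : ∀ ε : ℝ, 0 < ε → ∀ᶠ y in 𝓝 x,
      u x + p (y - x) + 1 / 2 * B (y - x) (y - x) - ε * ‖y - x‖ ^ 2 ≤ u y) :
    (gradient p, formMatrix B) ∈ subjet u x :=
  ⟨formMatrix_isSymm hB, fun ε hε => by simpa only [inner_gradient, inner_formMatrix] using h ε hε⟩

/-- The vectors `0, e₁, …, e_d`. -/
def vertex (i : Fin (d + 1)) : EuclideanSpace ℝ (Fin d) :=
  Fin.cons (α := fun _ => EuclideanSpace ℝ (Fin d)) 0 (fun i => EuclideanSpace.single i 1) i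

theorem extend_eq_inner (p : EuclideanSpace ℝ (Fin d)) (i : Fin (d + 1)) :
    extend p i = inner ℝ p (vertex i) := by
  refine Fin.cases ?_ (fun i => ?_) i
  · simp [extend, vertex]
  · simp [extend, vertex, EuclideanSpace.inner_single_right]

theorem extend_sub_extend (p : EuclideanSpace ℝ (Fin d)) (i j : Fin (d + 1)) :
    extend p i - extend p j = inner ℝ p (vertex i - vertex j) := by
  rw [inner_sub_right, extend_eq_inner, extend_eq_inner]

end Jets

/-! ### The constraint set: bounded, with `0` in its interior -/

section ConstraintSet

variable {d : ℕ} {lam : Fin (d + 1) → Fin (d + 1) → ℝ}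

theorem exists_norm_le_of_mem_constraintSet (lam : Fin (d + 1) → Fin (d + 1) → ℝ) :
    ∃ R : ℝ, 0 ≤ R ∧ ∀ p ∈ constraintSet lam, ‖p‖ ≤ R := by
  refine ⟨∑ i : Fin d, (|lam i.succ 0| + |lam 0 i.succ|), by positivity, fun p hp => ?_⟩
  rw [eq_sum_single p]
  refine norm_sum_le_of_le _ fun i _ => ?_
  rw [norm_smul, PiLp.norm_single, norm_one, mul_one, Real.norm_eq_abs]
  have h := hp i.succ 0
  simp only [extend, Fin.cons_succ, Fin.cons_zero, sub_zero] at h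
  have h1 := le_abs_self (lam i.succ 0)
  have h2 := le_abs_self (lam 0 i.succ)
  exact abs_le.2 ⟨by linarith [abs_nonneg (lam i.succ 0)], by linarith [abs_nonneg (lam 0 i.succ)]⟩

theorem exists_closedBall_subset_constraintSet (hlam_diag : ∀ i, lam i i = 0)
    (hlam_pos : ∀ i j, i ≠ j → 0 < lam i j) :
    ∃ c : ℝ, 0 < c ∧ ∀ p : EuclideanSpace ℝ (Fin d), ‖p‖ ≤ c → p ∈ constraintSet lam := by
  -- The factor `2` bounds `‖vertex i - vertex j‖`.
  have h1 : ∀ᶠ c in 𝓝[>] (0 : ℝ), ∀ i j, i ≠ j → c * 2 ≤ lam i j := by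
    rw [eventually_all]; intro i
    rw [eventually_all]; intro j
    by_cases hij : i = j
    · simp [hij]
    · have : ∀ᶠ c in 𝓝[>] (0 : ℝ), c < lam i j / 2 :=
        nhdsWithin_le_nhds (eventually_lt_nhds (half_pos (hlam_pos i j hij)))
      filter_upwards [this] with c hc _
      linarith
  obtain ⟨c, hc, hc0⟩ := (h1.and self_mem_nhdsWithin).exists
  refine ⟨c, hc0, fun p hp => ?_⟩
  have hv : ∀ i : Fin (d + 1), ‖(vertex i : EuclideanSpace ℝ (Fin d))‖ ≤ 1 := by
    refine Fin.cases ?_ fun i => ?_ <;> simp [vertex]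
  have key : ∀ i j, extend p i - extend p j ≤ lam i j := by
    intro i j
    by_cases hij : i = j
    · simp [hij, hlam_diag]
    · refine le_trans ?_ (hc i j hij)
      rw [extend_sub_extend]
      calc _ ≤ ‖p‖ * ‖vertex i - vertex j‖ := real_inner_le_norm _ _
        _ ≤ c * 2 := by
          have hc0' : (0 : ℝ) < c := hc0
          gcongr
          exact (norm_sub_le _ _).trans (by linarith [hv i, hv j])
  exact fun i j => ⟨by linarith [key j i], key i j⟩

theorem inner_le_supportFunction {u : EuclideanSpace ℝ (Fin d)} (hu : u ∈ constraintSet lam)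
    (x : EuclideanSpace ℝ (Fin d)) : inner ℝ u x ≤ supportFunction (constraintSet lam) x := by
  obtain ⟨R, -, hR⟩ := exists_norm_le_of_mem_constraintSet lam
  refine le_ciSup (f := fun u : constraintSet lam => inner ℝ (u : EuclideanSpace ℝ (Fin d)) x)
    ⟨R * ‖x‖, ?_⟩ ⟨u, hu⟩
  rintro _ ⟨v, rfl⟩
  exact (real_inner_le_norm _ _).trans (by have := hR v v.2; gcongr)

theorem supportFunction_le (h0 : (0 : EuclideanSpace ℝ (Fin d)) ∈ constraintSet lam)
    {x : EuclideanSpace ℝ (Fin d)} {c : ℝ} (h : ∀ u ∈ constraintSet lam, inner ℝ u x ≤ c) :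
    supportFunction (constraintSet lam) x ≤ c :=
  haveI : Nonempty (constraintSet lam) := ⟨⟨0, h0⟩⟩
  ciSup_le fun u => h u u.2

theorem exists_mul_norm_le_supportFunction (hlam_diag : ∀ i, lam i i = 0)
    (hlam_pos : ∀ i j, i ≠ j → 0 < lam i j) :
    ∃ c : ℝ, 0 < c ∧ ∀ x : EuclideanSpace ℝ (Fin d),
      c * ‖x‖ ≤ supportFunction (constraintSet lam) x := by
  obtain ⟨c, hc, h⟩ := exists_closedBall_subset_constraintSet hlam_diag hlam_pos
  refine ⟨c, hc, fun x => ?_⟩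
  rcases eq_or_ne x 0 with rfl | hx
  · simpa using inner_le_supportFunction (h 0 (by simpa using hc.le)) 0
  have hx' : 0 < ‖x‖ := norm_pos_iff.2 hx
  refine le_trans (le_of_eq ?_) (inner_le_supportFunction (h ((c / ‖x‖) • x) ?_) x)
  · rw [real_inner_smul_left, real_inner_self_eq_norm_sq]; field_simp
  · rw [norm_smul, Real.norm_of_nonneg (by positivity)]; field_simp; rfl

end ConstraintSet

/-! ### Growth at infinity, and Lipschitz-type bounds from gradients in superjets -/

section Growth

variable {d : ℕ} {w δ : EuclideanSpace ℝ (Fin d) → ℝ}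

theorem exists_le_of_limsup_le (hw : UpperSemicontinuous w) {c : ℝ} (hc : 0 < c)
    (hδ : ∀ x, c * ‖x‖ ≤ δ x)
    (h : limsup (fun x => ((w x / δ x : ℝ) : EReal)) (Bornology.cobounded _) ≤ 1)
    {ε : ℝ} (hε : 0 < ε) : ∃ A : ℝ, ∀ x, w x ≤ (1 + ε) * δ x + A := by
  have h1 : ∀ᶠ x in Bornology.cobounded (EuclideanSpace ℝ (Fin d)),
      ((w x / δ x : ℝ) : EReal) < ((1 + ε : ℝ) : EReal) :=
    eventually_lt_of_limsup_lt (h.trans_lt (by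
      rw [← EReal.coe_one, EReal.coe_lt_coe_iff]; linarith))
  obtain ⟨ρ, -, hρ⟩ := (Metric.hasBasis_cobounded_compl_closedBall
    (0 : EuclideanSpace ℝ (Fin d))).eventually_iff.1 h1
  obtain ⟨A, hA⟩ := (hw.upperSemicontinuousOn _).bddAbove_of_isCompact
    (isCompact_closedBall (0 : EuclideanSpace ℝ (Fin d)) (max ρ 0))
  refine ⟨max A 0, fun x => ?_⟩
  have hδ0 : 0 ≤ δ x := le_trans (by positivity) (hδ x)
  by_cases hx : x ∈ Metric.closedBall (0 : EuclideanSpace ℝ (Fin d)) (max ρ 0)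
  · have h2 : w x ≤ A := hA ⟨x, hx, rfl⟩
    have h3 : 0 ≤ (1 + ε) * δ x := by positivity
    linarith [le_max_left A 0]
  · rw [mem_closedBall_zero_iff, not_le, max_lt_iff] at hx
    have h2 := hρ (x := x) (by simpa using hx.1)
    rw [EReal.coe_lt_coe_iff, div_lt_iff₀ (lt_of_lt_of_le (mul_pos hc hx.2) (hδ x))] at h2
    linarith [le_max_right A 0]

theorem exists_le_of_le_liminf (hw : LowerSemicontinuous w) {c R : ℝ} (hc : 0 < c) (hR : 0 ≤ R)
    (hδ : ∀ x, c * ‖x‖ ≤ δ x) (hδ' : ∀ x, δ x ≤ R * ‖x‖)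
    (h : 1 ≤ liminf (fun x => ((w x / δ x : ℝ) : EReal)) (Bornology.cobounded _))
    {ε : ℝ} (hε : 0 < ε) : ∃ A : ℝ, ∀ x, (1 - ε) * δ x ≤ w x + A := by
  have h1 : ∀ᶠ x in Bornology.cobounded (EuclideanSpace ℝ (Fin d)),
      ((1 - ε : ℝ) : EReal) < ((w x / δ x : ℝ) : EReal) :=
    eventually_lt_of_lt_liminf (lt_of_lt_of_le (by
      rw [← EReal.coe_one, EReal.coe_lt_coe_iff]; linarith) h)
  obtain ⟨ρ, -, hρ⟩ := (Metric.hasBasis_cobounded_compl_closedBall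
    (0 : EuclideanSpace ℝ (Fin d))).eventually_iff.1 h1
  obtain ⟨A, hA⟩ := (hw.lowerSemicontinuousOn _).bddBelow_of_isCompact
    (isCompact_closedBall (0 : EuclideanSpace ℝ (Fin d)) (max ρ 0))
  refine ⟨max (R * max ρ 0 - A) 0, fun x => ?_⟩
  have hδ0 : 0 ≤ δ x := le_trans (by positivity) (hδ x)
  by_cases hx : x ∈ Metric.closedBall (0 : EuclideanSpace ℝ (Fin d)) (max ρ 0)
  · have h2 : A ≤ w x := hA ⟨x, hx, rfl⟩
    rw [mem_closedBall_zero_iff] at hx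
    have h3 : R * ‖x‖ ≤ R * max ρ 0 := by gcongr
    have h4 : 0 ≤ ε * δ x := by positivity
    linarith [le_max_left (R * max ρ 0 - A) 0, hδ' x]
  · rw [mem_closedBall_zero_iff, not_le, max_lt_iff] at hx
    have h2 := hρ (x := x) (by simpa using hx.1)
    rw [EReal.coe_lt_coe_iff, lt_div_iff₀ (lt_of_lt_of_le (mul_pos hc hx.2) (hδ x))] at h2
    linarith [le_max_right (R * max ρ 0 - A) 0]

theorem exists_forall_le_of_upperSemicontinuous (hw : UpperSemicontinuous w) {A k : ℝ}
    (hk : 0 < k) (h : ∀ x, w x ≤ A - k * ‖x‖) : ∃ x₀, ∀ x, w x ≤ w x₀ := by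
  obtain ⟨x₀, -, hx₀⟩ := (hw.upperSemicontinuousOn _).exists_isMaxOn
    (Metric.nonempty_closedBall.2 (le_max_right ((A - w 0) / k) 0))
    (isCompact_closedBall (0 : EuclideanSpace ℝ (Fin d)) (max ((A - w 0) / k) 0))
  refine ⟨x₀, fun x => ?_⟩
  by_cases hx : x ∈ Metric.closedBall (0 : EuclideanSpace ℝ (Fin d)) (max ((A - w 0) / k) 0)
  · exact hx₀ hx
  · rw [mem_closedBall_zero_iff, not_le, max_lt_iff, div_lt_iff₀ hk] at hx
    have h0 : w 0 ≤ w x₀ := hx₀ (Metric.mem_closedBall_self (le_max_right _ _))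
    linarith [h x]

/-- A function of controlled growth whose superjets have their gradients in the ball of centre `c`
and radius `r'` grows at most like the support function of a larger ball with the same centre. -/
theorem le_of_superjet_gradient (hw : UpperSemicontinuous w) {c : EuclideanSpace ℝ (Fin d)}
    {A r r' r'' : ℝ} (hr : 0 ≤ r) (hr' : r' < r) (hr'' : r'' < r)
    (hjet : ∀ x, ∀ q ∈ superjet w x, ‖q.1 - c‖ ≤ r')
    (hgrow : ∀ x, w x ≤ inner ℝ c x + r'' * ‖x‖ + A) (x y : EuclideanSpace ℝ (Fin d)) :
    w y ≤ w x + inner ℝ c (y - x) + r * ‖y - x‖ := by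
  -- Compare `w` with a tilted cone with vertex `x`. If the maximum is at the vertex the claim
  -- follows; elsewhere the cone is smooth and its gradient lies at distance `r > r'` from `c`.
  have husc : UpperSemicontinuous fun y => w y + (-inner ℝ c (y - x) - r * ‖y - x‖) :=
    hw.add (Continuous.upperSemicontinuous (by fun_prop))
  obtain ⟨y₀, hy₀⟩ := exists_forall_le_of_upperSemicontinuous husc (sub_pos.2 hr'')
    (A := A + inner ℝ c x + r * ‖x‖) fun z => by
      have h1 := hgrow z
      have h2 : r * ‖z‖ ≤ r * ‖z - x‖ + r * ‖x‖ := by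
        rw [← mul_add]
        gcongr
        simpa using norm_add_le (z - x) x
      rw [inner_sub_right]
      linarith
  by_cases hne : y₀ = x
  · have := hy₀ y
    simp only [hne, sub_self, inner_zero_right, norm_zero, mul_zero, neg_zero,
      add_zero] at this
    linarith
  exfalso
  have hm : 0 < ‖y₀ - x‖ := norm_pos_iff.2 (sub_ne_zero.2 hne)
  set m := ‖y₀ - x‖ with hmdef
  have hq := mem_superjet (u := w) (x := y₀) (p := innerForm _ (c + (r / m) • (y₀ - x)))
    (B := (r / m) • innerForm _) (fun v w => by
      simp only [smul_apply, innerForm_apply, real_inner_comm]) (by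
    intro ε hε
    refine Eventually.of_forall fun z => ?_
    have h1 := hy₀ z
    have h2 : ‖z - x‖ ^ 2 = m ^ 2 + 2 * inner ℝ (y₀ - x) (z - y₀) + ‖z - y₀‖ ^ 2 := by
      rw [hmdef, ← norm_add_sq_real]; congr 2; abel
    -- A paraboloid lies above the cone and touches it at distance `m` from `x`, so it supplies an
    -- explicit jet at `y₀` with Hessian `(r / m) I`.
    have h3 : ‖z - x‖ - m ≤ (‖z - x‖ ^ 2 - m ^ 2) / (2 * m) := by
      rw [le_div_iff₀ (by positivity)]
      nlinarith [sq_nonneg (‖z - x‖ - m)]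
    have h4 : r * (‖z - x‖ - m) ≤ (r / m) * inner ℝ (y₀ - x) (z - y₀)
        + 1 / 2 * ((r / m) * ‖z - y₀‖ ^ 2) := by
      calc _ ≤ r * ((‖z - x‖ ^ 2 - m ^ 2) / (2 * m)) := by gcongr
        _ = _ := by rw [h2]; field_simp; ring
    have h5 : inner ℝ c (z - x) - inner ℝ c (y₀ - x) = inner ℝ c (z - y₀) := by
      rw [← inner_sub_right]; congr 1; abel
    have h6 : 0 ≤ ε * ‖z - y₀‖ ^ 2 := by positivity
    simp only [innerForm_apply, smul_apply, smul_eq_mul, inner_add_left, real_inner_smul_left,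
      real_inner_self_eq_norm_sq]
    linarith)
  have h7 := hjet y₀ _ hq
  have hgr : gradient (innerForm _ (c + (r / m) • (y₀ - x))) = c + (r / m) • (y₀ - x) := by
    refine ext_inner_right ℝ fun v => ?_
    rw [inner_gradient, innerForm_apply]
  rw [hgr, add_sub_cancel_left, norm_smul, Real.norm_of_nonneg (by positivity), ← hmdef,
    div_mul_cancel₀ _ hm.ne'] at h7
  linarith

end Growth

/-! ### Regularity of the subsolution, and comparison with the supersolution -/

section Comparison

variable {d : ℕ} {sig alp : Matrix (Fin d) (Fin d) ℝ} {lam : Fin (d + 1) → Fin (d + 1) → ℝ}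
variable {a : ℝ} {w : EuclideanSpace ℝ (Fin d) → ℝ}

/-- The bilinear form `(v, w) ↦ σ v · σ w`. -/
def quadForm (sig : Matrix (Fin d) (Fin d) ℝ) :
    EuclideanSpace ℝ (Fin d) →L[ℝ] EuclideanSpace ℝ (Fin d) →L[ℝ] ℝ :=
  (innerForm _).bilinearComp (Matrix.toEuclideanLin sig).toContinuousLinearMap
    (Matrix.toEuclideanLin sig).toContinuousLinearMap

theorem quadForm_apply (v w : EuclideanSpace ℝ (Fin d)) : quadForm sig v w
    = inner ℝ (Matrix.toEuclideanLin sig v) (Matrix.toEuclideanLin sig w) := rfl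

theorem quadForm_self (v : EuclideanSpace ℝ (Fin d)) :
    quadForm sig v v = ‖Matrix.toEuclideanLin sig v‖ ^ 2 := by
  rw [quadForm_apply, real_inner_self_eq_norm_sq]

theorem IsViscositySubsolution.isLinearSubsolution
    (hw : IsViscositySubsolution sig alp lam a w) :
    IsLinearSubsolution (column alp) (fun x => 1 / 2 * quadForm sig x x - a) w := by
  intro x p B hB h
  have h1 := hw.2 x _ (mem_superjet hB h)
  rw [correctorOp, Finset.fold_max_le, trace_formMatrix] at h1
  simp only [quadForm_self]
  linarith [h1.1]

theorem IsViscositySubsolution.gradient_mem_constraintSet (hlam_diag : ∀ i, lam i i = 0)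
    (hw : IsViscositySubsolution sig alp lam a w) (x : EuclideanSpace ℝ (Fin d)) :
    ∀ q ∈ superjet w x, q.1 ∈ constraintSet lam := by
  intro q hq
  have h1 := hw.2 x q hq
  rw [correctorOp, Finset.fold_max_le] at h1
  have key : ∀ i j, extend q.1 i - extend q.1 j ≤ lam i j := by
    intro i j
    by_cases hij : i = j
    · simp [hij, hlam_diag]
    · have := h1.2 (i, j) (by simpa using hij)
      simp only at this
      linarith
  exact fun i j => ⟨by linarith [key j i], key i j⟩

/-- A subsolution grows at most like the support function of any ball containing the constraint
set in its interior. -/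
theorem IsViscositySubsolution.le_of_constraintSet_subset_closedBall
    (hlam_diag : ∀ i, lam i i = 0) (hlam_pos : ∀ i j, i ≠ j → 0 < lam i j)
    (hw : IsViscositySubsolution sig alp lam a w)
    (hsup : limsup (fun x => ((w x / supportFunction (constraintSet lam) x : ℝ) : EReal))
      (Bornology.cobounded (EuclideanSpace ℝ (Fin d))) ≤ 1)
    {c : EuclideanSpace ℝ (Fin d)} {r r' : ℝ} (hr : r' < r)
    (hsub : ∀ p ∈ constraintSet lam, ‖p - c‖ ≤ r') (x y : EuclideanSpace ℝ (Fin d)) :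
    w y ≤ w x + inner ℝ c (y - x) + r * ‖y - x‖ := by
  obtain ⟨R, hR0, hR⟩ := exists_norm_le_of_mem_constraintSet lam
  obtain ⟨k, hk, hδ⟩ := exists_mul_norm_le_supportFunction hlam_diag hlam_pos
  obtain ⟨b, hb, hball⟩ := exists_closedBall_subset_constraintSet hlam_diag hlam_pos
  have h0 : (0 : EuclideanSpace ℝ (Fin d)) ∈ constraintSet lam := hball 0 (by simpa using hb.le)
  have hr0 : 0 ≤ r' := (norm_nonneg _).trans (hsub 0 h0)
  -- Chosen so that `ε R < r - r'`: the excess `ε δ_C ≤ ε R ‖z‖` in the growth bound then fits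
  -- between the two radii.
  have hε : 0 < (r - r') / (2 * (R + 1)) := div_pos (sub_pos.2 hr) (by positivity)
  obtain ⟨A, hA⟩ := exists_le_of_limsup_le hw.1 hk hδ hsup hε
  set ε := (r - r') / (2 * (R + 1)) with hεdef
  have hεR : ε * R < r - r' := by
    have : ε * (2 * (R + 1)) = r - r' := by rw [hεdef]; field_simp
    nlinarith
  refine le_of_superjet_gradient hw.1 (r'' := r' + ε * R) (A := A) (by linarith) hr (by linarith)
    (fun x q hq => hsub _ (hw.gradient_mem_constraintSet hlam_diag x q hq)) (fun z => ?_) x y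
  refine (hA z).trans ?_
  have h1 : supportFunction (constraintSet lam) z ≤ inner ℝ c z + r' * ‖z‖ :=
    supportFunction_le h0 fun p hp => by
      have : inner ℝ (p - c) z ≤ r' * ‖z‖ :=
        (real_inner_le_norm _ _).trans (by have := hsub p hp; gcongr)
      rw [inner_sub_left] at this
      linarith
  have h2 : supportFunction (constraintSet lam) z ≤ R * ‖z‖ :=
    supportFunction_le h0 fun p hp =>
      (real_inner_le_norm _ _).trans (by have := hR p hp; gcongr)
  have h3 := mul_le_mul_of_nonneg_left h2 hε.le
  linarith

theorem IsViscositySubsolution.exists_lipschitz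
    (hlam_diag : ∀ i, lam i i = 0) (hlam_pos : ∀ i j, i ≠ j → 0 < lam i j)
    (hw : IsViscositySubsolution sig alp lam a w)
    (hsup : limsup (fun x => ((w x / supportFunction (constraintSet lam) x : ℝ) : EReal))
      (Bornology.cobounded (EuclideanSpace ℝ (Fin d))) ≤ 1) :
    ∃ R : ℝ, 0 ≤ R ∧ ∀ x y, ‖w x - w y‖ ≤ R * ‖x - y‖ := by
  obtain ⟨R, hR0, hR⟩ := exists_norm_le_of_mem_constraintSet lam
  have key := hw.le_of_constraintSet_subset_closedBall hlam_diag hlam_pos hsup (c := 0)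
    (lt_add_one R) (by simpa using hR)
  refine ⟨R + 1, by positivity, fun x y => abs_le.2 ?_⟩
  have h1 := key x y
  have h2 := key y x
  rw [inner_zero_left, add_zero] at h1 h2
  rw [norm_sub_rev] at h1
  constructor <;> linarith

/-- The constraint set lies in a half-space `p · v ≤ λ^{i,j}` and in the ball of radius `R`, hence
in a ball of centre `-n v` and radius `√Q`. As `n → ∞` the supports of these balls in direction `v`
tend to that of the half-space, so the bound for balls yields the sharp constant `λ^{i,j}`. -/
theorem IsViscositySubsolution.apply_add_smul_le
    (hlam_diag : ∀ i, lam i i = 0) (hlam_pos : ∀ i j, i ≠ j → 0 < lam i j)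
    (hw : IsViscositySubsolution sig alp lam a w)
    (hsup : limsup (fun x => ((w x / supportFunction (constraintSet lam) x : ℝ) : EReal))
      (Bornology.cobounded (EuclideanSpace ℝ (Fin d))) ≤ 1)
    (i j : Fin (d + 1)) (x : EuclideanSpace ℝ (Fin d)) {t : ℝ} (ht : 0 < t) :
    w (x + t • (vertex i - vertex j)) ≤ w x + t * lam i j := by
  obtain ⟨R, hR0, hR⟩ := exists_norm_le_of_mem_constraintSet lam
  set v : EuclideanSpace ℝ (Fin d) := vertex i - vertex j with hv
  have hl : 0 ≤ lam i j := by
    by_cases hij : i = j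
    · simp [hij, hlam_diag]
    · exact (hlam_pos i j hij).le
  have key : ∀ n : ℝ, 0 < n → w (x + t • v) ≤ w x + t * (lam i j + (R ^ 2 + 1) / 2 / n) := by
    intro n hn
    set Q := R ^ 2 + 2 * n * lam i j + n ^ 2 * ‖v‖ ^ 2 with hQ
    have hQ0 : 0 ≤ Q := by positivity
    have h1 := hw.le_of_constraintSet_subset_closedBall hlam_diag hlam_pos hsup
      (c := -(n • v)) (r' := √Q) (r := √(Q + 1)) (Real.sqrt_lt_sqrt hQ0 (lt_add_one Q))
      (fun p hp => by
        refine Real.le_sqrt_of_sq_le ?_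
        have h2 : inner ℝ p v ≤ lam i j := by
          rw [hv, ← extend_sub_extend]; exact (hp i j).2
        have h3 : ‖p‖ ^ 2 ≤ R ^ 2 := by have := hR p hp; gcongr
        rw [sub_neg_eq_add, norm_add_sq_real, real_inner_smul_right, norm_smul, mul_pow,
          Real.norm_eq_abs, sq_abs]
        nlinarith) x (x + t • v)
    rw [add_sub_cancel_left, inner_neg_left, real_inner_smul_left, real_inner_smul_right,
      real_inner_self_eq_norm_sq, norm_smul, Real.norm_of_nonneg ht.le] at h1
    have h4 : √(Q + 1) * ‖v‖ ≤ n * ‖v‖ ^ 2 + (lam i j + (R ^ 2 + 1) / 2 / n) := by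
      have h5 : √(Q + 1) ^ 2 = Q + 1 := Real.sq_sqrt (by positivity)
      have h6 : n * ‖v‖ ^ 2 + (lam i j + (R ^ 2 + 1) / 2 / n) - √(Q + 1) * ‖v‖
          = (√(Q + 1) - n * ‖v‖) ^ 2 / (2 * n) := by
        rw [sub_sq, h5, hQ]; field_simp; ring
      have h7 : 0 ≤ (√(Q + 1) - n * ‖v‖) ^ 2 / (2 * n) := by positivity
      linarith
    nlinarith
  refine ge_of_tendsto (x := atTop)
    (f := fun n : ℝ => w x + t * (lam i j + (R ^ 2 + 1) / 2 / n)) ?_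
    ((eventually_gt_atTop 0).mono key)
  have : Tendsto (fun n : ℝ => (R ^ 2 + 1) / 2 / n) atTop (𝓝 0) :=
    tendsto_const_nhds.div_atTop tendsto_id
  simpa using ((this.const_add (lam i j)).const_mul t).const_add (w x)

/-- Young's inequality with weight `ε`. The factor `1 + ε` is chosen to be absorbed through `(1 -
ε)(1 + ε) ≤ 1`. -/
theorem mollify_quadForm_le {r : ℝ} {φ : EuclideanSpace ℝ (Fin d) → ℝ} (hφ : IsMollifier r φ)
    {ε : ℝ} (hε : 0 < ε) (a : ℝ) (x : EuclideanSpace ℝ (Fin d)) :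
    mollify φ (fun x => 1 / 2 * quadForm sig x x - a) x
      ≤ (1 + ε) * (‖Matrix.toEuclideanLin sig x‖ ^ 2 / 2)
        + (1 + ε⁻¹) / 2 * (‖(Matrix.toEuclideanLin sig).toContinuousLinearMap‖ * r) ^ 2 - a := by
  set T := (Matrix.toEuclideanLin sig).toContinuousLinearMap with hT
  have hTx : ∀ y, Matrix.toEuclideanLin sig y = T y := fun _ => rfl
  rw [← hφ.mollify_const ((1 + ε) * (‖Matrix.toEuclideanLin sig x‖ ^ 2 / 2)
        + (1 + ε⁻¹) / 2 * (‖T‖ * r) ^ 2 - a) x]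
  refine hφ.mollify_le_mollify (by fun_prop) continuous_const fun z hz => ?_
  rw [quadForm_self, hTx, hTx, map_sub]
  have h1 : ‖T x - T z‖ ≤ ‖T x‖ + ‖T‖ * r :=
    (norm_sub_le _ _).trans (by
      have : ‖T z‖ ≤ ‖T‖ * r := (T.le_opNorm z).trans (by gcongr)
      linarith)
  have h2 : ‖T x - T z‖ ^ 2 ≤ (‖T x‖ + ‖T‖ * r) ^ 2 := by gcongr
  have h3 : (1 + ε) * ‖T x‖ ^ 2 + (1 + ε⁻¹) * (‖T‖ * r) ^ 2 - (‖T x‖ + ‖T‖ * r) ^ 2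
      = (ε * ‖T x‖ - ‖T‖ * r) ^ 2 / ε := by field_simp; ring
  have h4 : 0 ≤ (ε * ‖T x‖ - ‖T‖ * r) ^ 2 / ε := by positivity
  linarith

/-- The comparison argument: `(1 - ε)` times the mollified subsolution is a smooth test function for
`w₂` that satisfies the gradient constraints strictly. -/
theorem eigenvalue_le_of_mollify [NeZero d] {a₁ a₂ : ℝ} {w₁ w₂ : EuclideanSpace ℝ (Fin d) → ℝ}
    (hlam_diag : ∀ i, lam i i = 0) (hlam_pos : ∀ i j, i ≠ j → 0 < lam i j)
    (hw₁ : IsViscositySubsolution sig alp lam a₁ w₁)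
    (hw₂ : IsViscositySupersolution sig alp lam a₂ w₂)
    (hsup : limsup (fun x => ((w₁ x / supportFunction (constraintSet lam) x : ℝ) : EReal))
      (Bornology.cobounded (EuclideanSpace ℝ (Fin d))) ≤ 1)
    (hinf : 1 ≤ liminf (fun x => ((w₂ x / supportFunction (constraintSet lam) x : ℝ) : EReal))
      (Bornology.cobounded (EuclideanSpace ℝ (Fin d))))
    {ε r : ℝ} (hε : 0 < ε) (hε1 : ε < 1) (hr : 0 < r) :
    (1 - ε) * (a₁ - (1 + ε⁻¹) / 2
      * (‖(Matrix.toEuclideanLin sig).toContinuousLinearMap‖ * r) ^ 2) ≤ a₂ := by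
  obtain ⟨R, hR0, hul⟩ := hw₁.exists_lipschitz hlam_diag hlam_pos hsup
  have huc := continuous_of_lipschitz hul
  obtain ⟨φ, hφ, hφj⟩ := exists_isMollifier (EuclideanSpace ℝ (Fin d)) hr
  obtain ⟨K, G, H, hK, hj⟩ := hφj w₁ R hR0 hul
  have hgrad : ∀ x i j, G x (vertex i - vertex j) ≤ lam i j := fun x i j =>
    hj.apply_le fun t ht => hφ.mollify_le_add huc fun z => by
      have := hw₁.apply_add_smul_le hlam_diag hlam_pos hsup i j (x - z) ht
      rwa [sub_add_eq_add_sub] at this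
  obtain ⟨R', hR'0, hR'⟩ := exists_norm_le_of_mem_constraintSet lam
  obtain ⟨k, hk, hδ⟩ := exists_mul_norm_le_supportFunction hlam_diag hlam_pos
  obtain ⟨b, hb, hball⟩ := exists_closedBall_subset_constraintSet hlam_diag hlam_pos
  have h0 : (0 : EuclideanSpace ℝ (Fin d)) ∈ constraintSet lam := hball 0 (by simpa using hb.le)
  have hδ' : ∀ x, supportFunction (constraintSet lam) x ≤ R' * ‖x‖ := fun x =>
    supportFunction_le h0 fun p hp =>
      (real_inner_le_norm _ _).trans (by have := hR' p hp; gcongr)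
  have hε4 : 0 < ε / 4 := by positivity
  obtain ⟨A₁, hA₁⟩ := exists_le_of_limsup_le hw₁.1 hk hδ hsup hε4
  obtain ⟨A₂, hA₂⟩ := exists_le_of_le_liminf hw₂.1 hk hR'0 hδ hδ' hinf hε4
  have hclose := hφ.abs_mollify_sub_le hR0 hul
  have h1ε : 0 < 1 - ε := sub_pos.2 hε1
  have hmc := continuous_of_lipschitz (hφ.lipschitz_mollify hul)
  have husc : UpperSemicontinuous fun y => (1 - ε) * mollify φ w₁ y + -w₂ y :=
    (Continuous.upperSemicontinuous (by fun_prop)).add hw₂.1.neg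
  -- With tolerance `ε / 4` in both growth bounds, the coefficient of `δ_C` is `(1 - ε)(1 + ε/4) -
  -- (1 - ε/4) = -ε/2 - ε²/4`, whence the decay rate `ε/2 * k`.
  obtain ⟨x, hx⟩ := exists_forall_le_of_upperSemicontinuous husc
    (A := (1 - ε) * (A₁ + R * r) + A₂) (k := ε / 2 * k) (by positivity) fun y => by
      have h1 := (abs_le.1 (hclose y)).2
      have h2 : (1 - ε) * mollify φ w₁ y ≤ (1 - ε) *
          ((1 + ε / 4) * supportFunction (constraintSet lam) y + A₁ + R * r) := by
        gcongr
        linarith [hA₁ y]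
      have h3 := hA₂ y
      have h4 := hδ y
      have h5 : 0 ≤ supportFunction (constraintSet lam) y := le_trans (by positivity) h4
      have h6 : 0 ≤ ε ^ 2 * supportFunction (constraintSet lam) y := by positivity
      nlinarith
  have hjet := mem_subjet (u := w₂) (x := x) (p := (1 - ε) • G x) (B := (1 - ε) • H x)
    (fun v w => by simp only [smul_apply, hj.symm x v w]) (by
      intro θ hθ
      have hnear : ∀ᶠ y in 𝓝 x, K * ‖y - x‖ ≤ θ := by
        have : Tendsto (fun y => K * ‖y - x‖) (𝓝 x) (𝓝 (K * ‖x - x‖)) := by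
          apply Continuous.tendsto; fun_prop
        rw [sub_self, norm_zero, mul_zero] at this
        exact (this.eventually_lt_const hθ).mono fun _ h => h.le
      filter_upwards [hnear] with y hy
      have h1 := hx y
      have h2 := (abs_le.1 (hj.taylor x (y - x))).1
      rw [add_sub_cancel] at h2
      have h3 : K * ‖y - x‖ ^ 3 ≤ θ * ‖y - x‖ ^ 2 := by
        calc K * ‖y - x‖ ^ 3 = (K * ‖y - x‖) * ‖y - x‖ ^ 2 := by ring
          _ ≤ _ := by gcongr
      have h4 : (1 - ε) * (G x (y - x) + 1 / 2 * H x (y - x) (y - x) - K * ‖y - x‖ ^ 3)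
          ≤ (1 - ε) * (mollify φ w₁ y - mollify φ w₁ x) := by
        refine mul_le_mul_of_nonneg_left ?_ h1ε.le
        linarith
      have h5 : (1 - ε) * (K * ‖y - x‖ ^ 3) ≤ θ * ‖y - x‖ ^ 2 := by
        refine le_trans ?_ h3
        have : 0 ≤ K * ‖y - x‖ ^ 3 := by positivity
        nlinarith
      simp only [smul_apply, smul_eq_mul]
      linarith)
  have hop := hw₂.2 x _ hjet
  rw [correctorOp, Finset.le_fold_max, trace_formMatrix, secondOrder_smul] at hop
  have hmain := hw₁.isLinearSubsolution.mollify_le (fun v w => by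
    rw [quadForm_apply, quadForm_apply, real_inner_comm]) (fun v => by
      rw [quadForm_self]; positivity) hR0 hul hφ hK hj x
  have hq := mollify_quadForm_le (sig := sig) hφ hε a₁ x
  -- In the second-order branch the terms in `|σx|²` leave `ε²|σx|²/2` with the favourable sign. The
  -- gradient branch is impossible: it would give `λ^{i,j} ≤ (1 - ε) λ^{i,j}`.
  rcases hop with hop | ⟨⟨i, j⟩, hij, hop⟩
  · have h1 : (1 - ε) * (a₁ - (1 + ε⁻¹) / 2
        * (‖(Matrix.toEuclideanLin sig).toContinuousLinearMap‖ * r) ^ 2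
        - (1 + ε) * (‖Matrix.toEuclideanLin sig x‖ ^ 2 / 2))
        ≤ (1 - ε) * secondOrder (column alp) (H x) := by
      gcongr
      linarith
    have h2 : 0 ≤ ε ^ 2 * (‖Matrix.toEuclideanLin sig x‖ ^ 2 / 2) := by positivity
    linarith
  · have hl := hlam_pos i j (by simpa using hij)
    have h1 : extend (gradient ((1 - ε) • G x)) i - extend (gradient ((1 - ε) • G x)) j
        ≤ (1 - ε) * lam i j := by
      rw [extend_sub_extend, inner_gradient, smul_apply, smul_eq_mul]
      have := hgrad x i j
      gcongr
    simp only at hop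
    nlinarith

/-- In dimension `0` the walk has no directions to average over. The equation reduces to its
second-order branch, tested with the zero jet at the only point. -/
theorem eigenvalue_le_of_isEmpty {sig alp : Matrix (Fin 0) (Fin 0) ℝ}
    {lam : Fin (0 + 1) → Fin (0 + 1) → ℝ} {a₁ a₂ : ℝ} {w₁ w₂ : EuclideanSpace ℝ (Fin 0) → ℝ}
    (hw₁ : IsViscositySubsolution sig alp lam a₁ w₁)
    (hw₂ : IsViscositySupersolution sig alp lam a₂ w₂) : a₁ ≤ a₂ := by
  have h1 := hw₁.2 0 (0, 0) ⟨Matrix.isSymm_zero, fun ε _ => Eventually.of_forall fun y => by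
    simp [Subsingleton.elim y 0]⟩
  have h2 := hw₂.2 0 (0, 0) ⟨Matrix.isSymm_zero, fun ε _ => Eventually.of_forall fun y => by
    simp [Subsingleton.elim y 0]⟩
  rw [correctorOp, Finset.fold_max_le] at h1
  rw [correctorOp, Finset.le_fold_max] at h2
  rcases h2 with h2 | ⟨⟨i, j⟩, hij, -⟩
  · linarith [h1.1]
  · simp at hij

end Comparison

end Corrector

end

theorem mainTheorem3 {d : ℕ} (sig alp : Matrix (Fin d) (Fin d) ℝ)
    (lam : Fin (d + 1) → Fin (d + 1) → ℝ)
    (hlam_diag : ∀ i, lam i i = 0) (hlam_pos : ∀ i j, i ≠ j → 0 < lam i j)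
    (a₁ a₂ : ℝ) (w₁ w₂ : EuclideanSpace ℝ (Fin d) → ℝ)
    (hw₁ : Corrector.IsViscositySubsolution sig alp lam a₁ w₁)
    (hw₂ : Corrector.IsViscositySupersolution sig alp lam a₂ w₂)
    (hsup : limsup (fun x => ((w₁ x /
        Corrector.supportFunction (Corrector.constraintSet lam) x : ℝ) : EReal))
      (Bornology.cobounded (EuclideanSpace ℝ (Fin d))) ≤ 1)
    (hinf : 1 ≤ liminf (fun x => ((w₂ x /
        Corrector.supportFunction (Corrector.constraintSet lam) x : ℝ) : EReal))
      (Bornology.cobounded (EuclideanSpace ℝ (Fin d)))) :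
    a₁ ≤ a₂ := by
  rcases Nat.eq_zero_or_pos d with rfl | hd
  · exact Corrector.eigenvalue_le_of_isEmpty hw₁ hw₂
  have : NeZero d := ⟨hd.ne'⟩
  set N := ‖(Matrix.toEuclideanLin sig).toContinuousLinearMap‖
  -- The error contains `ε⁻¹ r²`, so `r → 0` is taken at fixed `ε`, and `ε → 0` afterwards.
  have key : ∀ ε : ℝ, 0 < ε → ε < 1 → (1 - ε) * a₁ ≤ a₂ := by
    intro ε hε hε1
    have hc : Continuous fun r : ℝ => (1 - ε) * (a₁ - (1 + ε⁻¹) / 2 * (N * r) ^ 2) := by fun_prop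
    refine le_of_tendsto (x := 𝓝[>] (0 : ℝ))
      (f := fun r : ℝ => (1 - ε) * (a₁ - (1 + ε⁻¹) / 2 * (N * r) ^ 2))
      (tendsto_nhdsWithin_of_tendsto_nhds ?_) (by
        filter_upwards [self_mem_nhdsWithin] with r hr using
          Corrector.eigenvalue_le_of_mollify hlam_diag hlam_pos hw₁ hw₂ hsup hinf hε hε1 hr)
    convert hc.tendsto 0 using 2
    ring
  have hc : Continuous fun ε : ℝ => (1 - ε) * a₁ := by fun_prop
  refine le_of_tendsto (x := 𝓝[>] (0 : ℝ)) (f := fun ε : ℝ => (1 - ε) * a₁)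
    (tendsto_nhdsWithin_of_tendsto_nhds ?_) (by
      filter_upwards [self_mem_nhdsWithin,
        nhdsWithin_le_nhds (eventually_lt_nhds (zero_lt_one' ℝ))] with ε hε hε1 using key ε hε hε1)
  convert hc.tendsto 0 using 2
  ring
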